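/- Theorem (Existence of a skew-product flow). \label{thm:skew_product} Let $m\ge 1$, $1\le k<n-1$, let $F_0,\dots,F_m:\mathbb{R}^n\to\mathbb{R}^n$ be $C^\infty$ and consider $$z'=F(z,\varepsilon):=\sum_{i=0}^m\varepsilon^iF_i(z),\qquad z\in\mathbb{R}^n .$$ Write $\mathbb{S}^1=\mathbb{R}/2\pi\mathbb{Z}$, let $U\subset\mathbb{R}^k$ be open and suppose that the layer problem $z'=F_0(z)$ has periodic solutions $t\mapsto\gamma_0(x,t)$, $x\in U$, with periods $\tau(x)>0$, where $\tau$ is smooth, such that, with $\omega(x)=2\pi/\tau(x)$, the map $\Gamma_0(x,\phi):=\gamma_0(x,\phi/\omega(x))$ is a smooth embedding $U\times\mathbb{S}^1\to\mathbb{R}^n$. Let $M_0=\Gamma_0(U\times\mathbb{S}^1)$. Suppose that $M_0$ is normally hyperbolic in the following sense: there are linear subspaces $\mathcal{N}^s_z,\mathcal{N}^u_z$ with $\mathbb{R}^n=T_zM_0\oplus\mathcal{N}^s_z\oplus\mathcal{N}^u_z$ for $z\in M_0$, which are invariant under the transition matrices $\Phi(x,t,t_0)$ of the variational equations $\zeta'=DF_0(\gamma_0(x,t))\zeta$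 along the orbits, and there is $\lambda>0$, and for every $x\in U$ some $K\ge 1$, such that for all $t_0,t\in\mathbb{R}$ $$\|\Phi(x,t,t_0)v\|\le Ke^{-\lambda(t-t_0)}\|v\|\ \text{ for } v\in\mathcal{N}^s_{\gamma_0(x,t_0)},\ t\ge t_0,\qquad \|\Phi(x,t,t_0)v\|\le Ke^{\lambda(t-t_0)}\|v\|\ \text{ for } v\in\mathcal{N}^u_{\gamma_0(x,t_0)},\ t\le t_0 .$$ Then there are smooth functions $r_{x,i}:U\to\mathbb{R}^k$, $r_{\phi,i}:U\to\mathbb{R}$ and $\Gamma_i:U\times\mathbb{S}^1\to\mathbb{R}^n$, $1\le i\le m$, such that $$r_x(x,\varepsilon)=\sum_{i=1}^m\varepsilon^ir_{x,i}(x),\quad r_\phi(x,\varepsilon)=\omega(x)+\sum_{i=1}^m\varepsilon^ir_{\phi,i}(x),\quad \Gamma(x,\phi,\varepsilon)=\Gamma_0(x,\phi)+\sum_{i=1}^m\varepsilon^i\Gamma_i(x,\phi)$$ have the following property. For every open $V$ whose closure is compact and contained in $U$ there are $\varepsilon_0>0$ and $C$ such that for all $|\varepsilon|\le\varepsilon_0$: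 (a) $\Gamma(\cdot,\cdot,\varepsilon)$ is a smooth embedding of $V\times\mathbb{S}^1$ into $\mathbb{R}^n$; (b) if $(x(t),\phi(t))$, with $t$ in an interval and $x(t)\in V$, solves the skew-product system $$x'=r_x(x,\varepsilon),\qquad \phi'=r_\phi(x,\varepsilon),$$ then $z(t):=\Gamma(x(t),\phi(t),\varepsilon)$ satisfies $z'=F(z,\varepsilon)+R(t)$ with $\|R(t)\|\le C|\varepsilon|^{m+1}$; that is, $z'=F(z,\varepsilon)+\mathcal{O}(\varepsilon^{m+1})$. -/

import Mathlib

open scoped ContDiff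
open Set

noncomputable section

namespace SkewProduct

/-- `ℝ^d` with the Euclidean norm. -/
abbrev E (d : ℕ) : Type := EuclideanSpace ℝ (Fin d)

/-- The vector field `F(z, ε) = ∑_{i=0}^m ε^i F_i(z)`. -/
def perturbedField {n : ℕ} (F : ℕ → E n → E n) (m : ℕ) (ε : ℝ) (z : E n) : E n :=
  ∑ i ∈ Finset.range (m + 1), ε ^ i • F i z

/-- `G : V × 𝕊¹ → ℝ^n`, written as a function `G x φ` of `x ∈ V` and a real phase `φ`, is a smooth
embedding, where `V` is an open subset of `ℝ^k` and `𝕊¹ = ℝ / 2πℤ`: it is smooth, its derivative has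
full rank `k + 1` everywhere, and it descends to a homeomorphism of `V × 𝕊¹` onto its image
(in particular it is `2π`-periodic in `φ`). -/
structure IsSmoothEmbedding {k n : ℕ} (V : Set (E k)) (G : E k → ℝ → E n) : Prop where
  smooth : ContDiffOn ℝ ∞ (fun p : E k × ℝ => G p.1 p.2) (V ×ˢ univ)
  immersion : ∀ x ∈ V, ∀ φ : ℝ,
    Function.Injective (fderiv ℝ (fun p : E k × ℝ => G p.1 p.2) (x, φ))
  embedding : ∃ g : V × AddCircle (2 * Real.pi) → E n, Topology.IsEmbedding g ∧
    ∀ (x : V) (φ : ℝ), g (x, (φ : AddCircle (2 * Real.pi))) = G x φ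

/-- The frequency `ω(x) = 2π / τ(x)`. -/
def freq {k : ℕ} (τ : E k → ℝ) (x : E k) : ℝ := 2 * Real.pi / τ x

/-- The parametrisation `Γ₀(x, φ) = γ₀(x, φ / ω(x))` by parameter and phase. -/
def phaseParam {k n : ℕ} (γ₀ : E k → ℝ → E n) (τ : E k → ℝ) (x : E k) (φ : ℝ) : E n :=
  γ₀ x (φ / freq τ x)

/-- `γ₀(x, ·)`, `x ∈ U`, is a smooth `k`-parameter family of periodic orbits of `z' = F₀(z)` with
periods `τ(x)`, which forms an embedded `(k+1)`-dimensional manifold `M₀ = Γ₀(U × 𝕊¹)`. -/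
structure IsPeriodicOrbitFamily {k n : ℕ} (F₀ : E n → E n) (U : Set (E k))
    (γ₀ : E k → ℝ → E n) (τ : E k → ℝ) : Prop where
  isOpen : IsOpen U
  period_pos : ∀ x ∈ U, 0 < τ x
  period_smooth : ContDiffOn ℝ ∞ τ U
  solution : ∀ x ∈ U, ∀ t : ℝ, HasDerivAt (γ₀ x) (F₀ (γ₀ x t)) t
  periodic : ∀ x ∈ U, Function.Periodic (γ₀ x) (τ x)
  embedding : IsSmoothEmbedding U (phaseParam γ₀ τ)

/-- `ζ` solves the variational equation `ζ' = DF₀(γ(t)) ζ` along `γ`. In terms of the transition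
matrix `Φ(t, t₀)` of this linear equation, `ζ(t) = Φ(t, t₀) ζ(t₀)`. -/
def IsVariationalSolution {n : ℕ} (F₀ : E n → E n) (γ ζ : ℝ → E n) : Prop :=
  ∀ t : ℝ, HasDerivAt ζ (fderiv ℝ F₀ (γ t) (ζ t)) t

/-- The tangent space `T_z M₀` at `z = Γ₀(x, φ)`, the range of `DΓ₀(x, φ)`. -/
def tangentSpace {k n : ℕ} (γ₀ : E k → ℝ → E n) (τ : E k → ℝ) (x : E k) (φ : ℝ) :
    Submodule ℝ (E n) :=
  LinearMap.range (fderiv ℝ (fun p : E k × ℝ => phaseParam γ₀ τ p.1 p.2) (x, φ)).toLinearMap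

/-- Normal hyperbolicity of `M₀`, by exponential dichotomies: at the points `z` of `M₀` there are
subspaces `Ns z` and `Nu z` with `ℝ^n = T_z M₀ ⊕ Ns z ⊕ Nu z` that are invariant under the linearised
flow along the orbits; vectors in `Ns` decay exponentially in forward time, those in `Nu` in
backward time, with an exponent bounded away from `0`. -/
def IsNormallyHyperbolic {k n : ℕ} (F₀ : E n → E n) (U : Set (E k))
    (γ₀ : E k → ℝ → E n) (τ : E k → ℝ) : Prop :=
  ∃ (Ns Nu : E n → Submodule ℝ (E n)) (lam : ℝ), 0 < lam ∧ ∀ x ∈ U,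
    (∀ t : ℝ, Disjoint (Ns (γ₀ x t)) (Nu (γ₀ x t)) ∧
      IsCompl (tangentSpace γ₀ τ x (freq τ x * t)) (Ns (γ₀ x t) ⊔ Nu (γ₀ x t))) ∧
    (∀ ζ : ℝ → E n, IsVariationalSolution F₀ (γ₀ x) ζ → ∀ t₀ t : ℝ,
      (ζ t₀ ∈ Ns (γ₀ x t₀) → ζ t ∈ Ns (γ₀ x t)) ∧ (ζ t₀ ∈ Nu (γ₀ x t₀) → ζ t ∈ Nu (γ₀ x t))) ∧
    ∃ K : ℝ, 1 ≤ K ∧ ∀ ζ : ℝ → E n, IsVariationalSolution F₀ (γ₀ x) ζ → ∀ t₀ t : ℝ,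
      (ζ t₀ ∈ Ns (γ₀ x t₀) → t₀ ≤ t → ‖ζ t‖ ≤ K * Real.exp (-lam * (t - t₀)) * ‖ζ t₀‖) ∧
      (ζ t₀ ∈ Nu (γ₀ x t₀) → t ≤ t₀ → ‖ζ t‖ ≤ K * Real.exp (lam * (t - t₀)) * ‖ζ t₀‖)

/-- `r_x(x, ε) = ∑_{i=1}^m ε^i r_{x,i}(x)`. -/
def slowField {k : ℕ} (rx : ℕ → E k → E k) (m : ℕ) (x : E k) (ε : ℝ) : E k :=
  ∑ i ∈ Finset.Icc 1 m, ε ^ i • rx i x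

/-- `r_φ(x, ε) = ω(x) + ∑_{i=1}^m ε^i r_{φ,i}(x)`. -/
def phaseField {k : ℕ} (τ : E k → ℝ) (rφ : ℕ → E k → ℝ) (m : ℕ) (x : E k) (ε : ℝ) : ℝ :=
  freq τ x + ∑ i ∈ Finset.Icc 1 m, ε ^ i * rφ i x

/-- `Γ(x, φ, ε) = Γ₀(x, φ) + ∑_{i=1}^m ε^i Γ_i(x, φ)`. -/
def expansion {k n : ℕ} (γ₀ : E k → ℝ → E n) (τ : E k → ℝ) (Γ : ℕ → E k → ℝ → E n) (m : ℕ)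
    (x : E k) (φ ε : ℝ) : E n :=
  phaseParam γ₀ τ x φ + ∑ i ∈ Finset.Icc 1 m, ε ^ i • Γ i x φ

end SkewProduct

end

/-! By the chain rule, `Γ(x(t), φ(t), ε)` solves the perturbed equation up to the defect `F(Γ, ε) -
DΓ · (r_x, r_φ)`. It therefore suffices to make this defect equal to `ε^(m+1) H` with `H` smooth and
periodic in the phase; a bound for `H` on a compact set then gives `C`. This is done by induction on
the order (`IsApproximateConjugacy`). If the defect is `ε^j H`, adding `ε^j Γ_j` and `ε^j r_j` gains
one power of `ε` as soon as the homological equation `ω ∂_φ Γ_j = DF₀(Γ₀) Γ_j + H(·, 0) - DΓ₀ r_j`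
holds (`IsApproximateConjugacy.exists_succ`).

For fixed `x` this is a linear differential equation in `φ`, and a solution is `2π`-periodic iff its
values at `0` and `2π` agree. That is an affine condition on the initial value and on `r_j`,
solvable because its linear part is onto (`surjective_solution_operator`). On the normal directions
the monodromy operator minus the identity is invertible: a fixed vector would give a periodic
solution of the variational equation that also decays exponentially. The tangential directions are
reached through `r_j`, since `DΓ₀` solves the variational equation up to an explicit term from the
varying frequency.

A surjection `B` has the right inverse `B*(BB*)⁻¹`, which is smooth in `B`
(`exists_smooth_rightInverse`). Hence the solution can be chosen smoothly in `x`, although the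
stable and unstable subspaces need not vary smoothly. Smooth dependence of solutions on parameters
(`exists_linear_ode`) comes from inverting a Volterra operator on continuous curves. The embedding
property persists by compactness (`exists_isSmoothEmbedding_perturbation`). -/

namespace SkewProduct

open unitInterval Filter Topology
open scoped BoundedContinuousFunction

/-! ### The Banach space of continuous curves. -/

section CurveSpace

/-- The Banach space of continuous curves `[0, 1] → F`. -/
def Curve (F : Type) [NormedAddCommGroup F] : Type := I →ᵇ F

variable {F : Type} [NormedAddCommGroup F]

noncomputable instance : NormedAddCommGroup (Curve F) :=
  inferInstanceAs (NormedAddCommGroup (I →ᵇ F))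

noncomputable instance [NormedSpace ℝ F] : NormedSpace ℝ (Curve F) :=
  inferInstanceAs (NormedSpace ℝ (I →ᵇ F))

instance [CompleteSpace F] : CompleteSpace (Curve F) :=
  inferInstanceAs (CompleteSpace (I →ᵇ F))

namespace Curve

instance : FunLike (Curve F) I F := inferInstanceAs (FunLike (I →ᵇ F) I F)

@[ext] lemma ext {g h : Curve F} (H : ∀ s, g s = h s) : g = h := DFunLike.ext _ _ H

@[fun_prop] lemma continuous (g : Curve F) : Continuous g :=
  BoundedContinuousFunction.continuous (α := I) (β := F) g

/-- A continuous function on `[0, 1]` as an element of `Curve F`. -/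
noncomputable def mk (f : I → F) (hf : Continuous f) : Curve F :=
  BoundedContinuousFunction.mkOfCompact ⟨f, hf⟩

@[simp] lemma mk_apply (f : I → F) (hf : Continuous f) (s : I) : mk f hf s = f s := rfl

@[simp] lemma add_apply (g h : Curve F) (s : I) : (g + h) s = g s + h s := rfl

@[simp] lemma sub_apply (g h : Curve F) (s : I) : (g - h) s = g s - h s := rfl

@[simp] lemma smul_apply [NormedSpace ℝ F] (c : ℝ) (g : Curve F) (s : I) :
    (c • g) s = c • g s := rfl

lemma norm_apply_le (g : Curve F) (s : I) : ‖g s‖ ≤ ‖g‖ :=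
  BoundedContinuousFunction.norm_coe_le_norm (α := I) (β := F) g s

lemma norm_le {g : Curve F} {c : ℝ} (hc : 0 ≤ c) : ‖g‖ ≤ c ↔ ∀ s, ‖g s‖ ≤ c :=
  BoundedContinuousFunction.norm_le (α := I) (β := F) hc

end Curve

end CurveSpace

/-! ### Smooth functions of parameter and time as smooth maps into the space of curves. -/

section Curry

variable {P F : Type} [NormedAddCommGroup P] [NormedSpace ℝ P] [NormedAddCommGroup F]
  [NormedSpace ℝ F]

/-- A curve of operators `P →L F` as an operator into curves. -/
noncomputable def curveFlip (P F : Type) [NormedAddCommGroup P] [NormedSpace ℝ P] [NormedAddCommGroup F]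
    [NormedSpace ℝ F] : Curve (P →L[ℝ] F) →L[ℝ] P →L[ℝ] Curve F :=
  LinearMap.mkContinuous₂
    (LinearMap.mk₂ ℝ (fun (g : Curve (P →L[ℝ] F)) (v : P) =>
        Curve.mk (fun s => g s v) (by fun_prop))
      (fun _ _ _ => by ext; simp) (fun _ _ _ => by ext; simp)
      (fun _ _ _ => by ext; simp) (fun _ _ _ => by ext; simp)) 1
    (fun g v => by
      rw [Curve.norm_le (by positivity)]
      intro s
      simp only [LinearMap.mk₂_apply, Curve.mk_apply, one_mul]
      exact ((g s).le_opNorm v).trans (by gcongr; exact g.norm_apply_le s))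

@[simp] lemma curveFlip_apply (g : Curve (P →L[ℝ] F)) (v : P) (s : I) :
    curveFlip P F g v s = g s v := rfl

-- Compactness of `[0, 1]` turns continuity at each `(p, s)` into closeness uniform in `s`, which is
-- closeness in the norm of `Curve F`.
omit [NormedSpace ℝ P] [NormedSpace ℝ F] in
lemma continuousOn_curry {W : Set P} (hW : IsOpen W) {f : P × ℝ → F}
    (hf : ContinuousOn f (W ×ˢ univ))
    {g : P → Curve F} (hg : ∀ p ∈ W, ∀ s : I, g p s = f (p, s)) : ContinuousOn g W := by
  intro p hp
  apply ContinuousAt.continuousWithinAt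
  rw [Metric.continuousAt_iff']
  intro ε hε
  have key : ∀ᶠ q in 𝓝 p, ∀ s ∈ (univ : Set I), q ∈ W ∧ dist (f (q, s)) (f (p, s)) < ε / 2 := by
    apply isCompact_univ.eventually_forall_of_forall_eventually
    intro s _
    have hcf : ContinuousAt f (p, (s : ℝ)) :=
      hf.continuousAt ((hW.prod isOpen_univ).mem_nhds ⟨hp, mem_univ _⟩)
    have h1 : ContinuousAt (fun z : P × I => f (z.1, (z.2 : ℝ))) (p, s) :=
      ContinuousAt.comp (f := fun z : P × I => (z.1, (z.2 : ℝ))) hcf (by fun_prop)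
    have h2 : ContinuousAt (fun z : P × I => f (p, (z.2 : ℝ))) (p, s) :=
      ContinuousAt.comp (f := fun z : P × I => (p, (z.2 : ℝ))) hcf (by fun_prop)
    have h3 : Tendsto (fun z : P × I => dist (f (z.1, (z.2 : ℝ))) (f (p, (z.2 : ℝ))))
        (𝓝 (p, s)) (𝓝 0) := by
      simpa using h1.dist h2
    exact (continuous_fst.continuousAt.eventually_mem (hW.mem_nhds hp)).and
      (h3.eventually (gt_mem_nhds (half_pos hε)))
  filter_upwards [key] with q hq
  rw [dist_eq_norm]
  refine lt_of_le_of_lt ((Curve.norm_le (half_pos hε).le).2 fun s => ?_) (half_lt_self hε)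
  rw [Curve.sub_apply, hg q (hq s (mem_univ s)).1, hg p hp, ← dist_eq_norm]
  exact (hq s (mem_univ s)).2.le

omit [NormedSpace ℝ P] [NormedSpace ℝ F] in
lemma exists_curry {W : Set P} {f : P × ℝ → F} (hf : ContinuousOn f (W ×ˢ univ)) :
    ∃ g : P → Curve F, ∀ p ∈ W, ∀ s : I, g p s = f (p, s) := by
  classical
  refine ⟨fun p => if hp : p ∈ W then
    Curve.mk (fun s => f (p, s)) ?_ else 0, ?_⟩
  · exact hf.comp_continuous (by fun_prop) (fun s => ⟨hp, mem_univ _⟩)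
  · intro p hp s
    simp [hp]

lemma hasFDerivAt_slice {W : Set P} (hW : IsOpen W) {f : P × ℝ → F}
    (hf : DifferentiableOn ℝ f (W ×ˢ univ)) {p : P} (hp : p ∈ W) (s : ℝ) :
    HasFDerivAt (fun q => f (q, s))
      ((fderiv ℝ f (p, s)).comp (ContinuousLinearMap.inl ℝ P ℝ)) p := by
  have h1 : HasFDerivAt f (fderiv ℝ f (p, s)) (p, s) :=
    (hf.differentiableAt ((hW.prod isOpen_univ).mem_nhds ⟨hp, mem_univ _⟩)).hasFDerivAt
  exact h1.comp p (hasFDerivAt_prodMk_left p s)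

/-- By continuity of `g'`, the partial derivatives vary by at most `c` on a ball around `p`,
uniformly in `s`. The mean value inequality then bounds the remainder by `c ‖q - p‖` for all `s` at
once. -/
lemma hasFDerivAt_curry {W : Set P} (hW : IsOpen W) {f : P × ℝ → F}
    (hf : DifferentiableOn ℝ f (W ×ˢ univ)) (hf' : ContinuousOn (fderiv ℝ f) (W ×ˢ univ))
    {g : P → Curve F} (hg : ∀ p ∈ W, ∀ s : I, g p s = f (p, s))
    {g' : P → Curve (P →L[ℝ] F)}
    (hg' : ∀ p ∈ W, ∀ s : I,
      g' p s = (fderiv ℝ f (p, s)).comp (ContinuousLinearMap.inl ℝ P ℝ))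
    {p : P} (hp : p ∈ W) : HasFDerivAt g (curveFlip P F (g' p)) p := by
  have hcont : ContinuousOn g' W :=
    continuousOn_curry hW (f := fun q => (fderiv ℝ f q).comp (ContinuousLinearMap.inl ℝ P ℝ))
      (hf'.clm_comp continuousOn_const) hg'
  rw [hasFDerivAt_iff_isLittleO, Asymptotics.isLittleO_iff]
  intro c hc
  have h1 : ∀ᶠ q in 𝓝 p, g' q ∈ Metric.closedBall (g' p) c :=
    (hcont.continuousAt (hW.mem_nhds hp)).eventually_mem (Metric.closedBall_mem_nhds _ hc)
  obtain ⟨r, hr, hball⟩ := Metric.eventually_nhds_iff_ball.1 (h1.and (hW.mem_nhds hp))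
  filter_upwards [Metric.ball_mem_nhds p hr] with q hq
  rw [Curve.norm_le (by positivity)]
  intro s
  have := (convex_ball p r).norm_image_sub_le_of_norm_hasFDerivWithin_le'
    (f := fun q => f (q, (s : ℝ)))
    (f' := fun q => (fderiv ℝ f (q, s)).comp (ContinuousLinearMap.inl ℝ P ℝ)) (φ := g' p s)
    (C := c) (fun y hy => (hasFDerivAt_slice hW hf (hball y hy).2 s).hasFDerivWithinAt)
    (fun y hy => by
      have h2 := (hball y hy).1
      rw [← hg' y (hball y hy).2 s, ← Curve.sub_apply]
      refine ((g' y - g' p).norm_apply_le s).trans ?_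
      rwa [← dist_eq_norm])
    (Metric.mem_ball_self hr) hq
  simpa [hg q (hball q hq).2 s, hg p hp s] using this

/-- The derivative of the curried map is, up to the bounded operator `curveFlip`, the curried
partial derivative. Its target is `P →L[ℝ] F`, so the induction must range over all `F`. -/
lemma contDiffOn_curry_nat (k : ℕ) : ∀ {F : Type} [NormedAddCommGroup F] [NormedSpace ℝ F]
    {W : Set P} (_ : IsOpen W) {f : P × ℝ → F} (_ : ContDiffOn ℝ k f (W ×ˢ univ))
    {g : P → Curve F} (_ : ∀ p ∈ W, ∀ s : I, g p s = f (p, s)), ContDiffOn ℝ k g W := by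
  induction k with
  | zero =>
    intro F _ _ W hW f hf g hg
    exact contDiffOn_zero.2 (continuousOn_curry hW (contDiffOn_zero.1 hf) hg)
  | succ k ih =>
    intro F _ _ W hW f hf g hg
    have hWo := hW.prod (isOpen_univ (X := ℝ))
    push_cast at hf ⊢
    rw [contDiffOn_succ_iff_fderiv_of_isOpen hWo] at hf
    rw [contDiffOn_succ_iff_fderiv_of_isOpen hW]
    have hf'' : ContDiffOn ℝ k
        (fun q => (fderiv ℝ f q).comp (ContinuousLinearMap.inl ℝ P ℝ)) (W ×ˢ univ) :=
      hf.2.2.clm_comp contDiffOn_const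
    obtain ⟨g', hg'⟩ := exists_curry hf''.continuousOn
    have hd : ∀ p ∈ W, HasFDerivAt g (curveFlip P F (g' p)) p := fun p hp =>
      hasFDerivAt_curry hW hf.1 hf.2.2.continuousOn hg hg' hp
    refine ⟨fun p hp => (hd p hp).differentiableAt.differentiableWithinAt, by simp, ?_⟩
    have hc : ContDiffOn ℝ k (fun p => curveFlip P F (g' p)) W :=
      (curveFlip P F).contDiff.comp_contDiffOn (ih hW hf'' hg')
    exact hc.congr fun p hp => (hd p hp).fderiv

/-- If `f` is smooth on `W × ℝ` then `p ↦ f (p, ·)` is a smooth map into `C([0,1], F)`. -/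
lemma contDiffOn_curry {W : Set P} (hW : IsOpen W) {f : P × ℝ → F}
    (hf : ContDiffOn ℝ ∞ f (W ×ˢ univ)) {g : P → Curve F}
    (hg : ∀ p ∈ W, ∀ s : I, g p s = f (p, s)) : ContDiffOn ℝ ∞ g W :=
  contDiffOn_infty.2 fun k => contDiffOn_curry_nat k hW (contDiffOn_infty.1 hf k) hg

end Curry

/-! ### Primitives and Volterra operators on curves. -/

section Integral

variable {P F : Type} [NormedAddCommGroup P] [NormedSpace ℝ P] [NormedAddCommGroup F]
  [NormedSpace ℝ F]

namespace Curve

omit [NormedSpace ℝ F] in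
@[fun_prop] lemma continuous_projIcc (g : Curve F) :
    Continuous fun t : ℝ => g (projIcc 0 1 zero_le_one t) :=
  g.continuous.comp _root_.continuous_projIcc

omit [NormedSpace ℝ F] in
lemma intervalIntegrable_projIcc (g : Curve F) (a b : ℝ) :
    IntervalIntegrable (fun t : ℝ => g (projIcc 0 1 zero_le_one t)) MeasureTheory.volume a b :=
  g.continuous_projIcc.intervalIntegrable a b

/-- The primitive of a curve vanishing at `0`. -/
noncomputable def primitive (F : Type) [NormedAddCommGroup F] [NormedSpace ℝ F] :
    Curve F →L[ℝ] Curve F :=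
  LinearMap.mkContinuous
    { toFun := fun g => Curve.mk
        (fun s => ∫ t in (0 : ℝ)..s, g (projIcc 0 1 zero_le_one t))
        ((intervalIntegral.continuous_primitive (g.intervalIntegrable_projIcc) 0).comp
          continuous_subtype_val)
      map_add' := fun g h => by
        ext s
        simp [intervalIntegral.integral_add (g.intervalIntegrable_projIcc _ _)
          (h.intervalIntegrable_projIcc _ _)]
      map_smul' := fun c g => by
        ext s
        simp } 1
    (fun g => by
      rw [Curve.norm_le (by positivity)]
      intro s
      have h := intervalIntegral.norm_integral_le_of_norm_le_const (a := 0) (b := (s : ℝ))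
        (f := fun t : ℝ => g (projIcc 0 1 zero_le_one t)) (C := ‖g‖)
        (fun t _ => g.norm_apply_le _)
      refine h.trans ?_
      rw [mul_comm, sub_zero, abs_of_nonneg s.2.1]
      exact mul_le_mul_of_nonneg_right s.2.2 (norm_nonneg _))

lemma primitive_apply (g : Curve F) (s : I) :
    primitive F g s = ∫ t in (0 : ℝ)..s, g (projIcc 0 1 zero_le_one t) := rfl

lemma contDiff_eval_one {k : WithTop ℕ∞} : ContDiff ℝ k (fun c : Curve F => c 1) := by
  have : IsBoundedLinearMap ℝ (fun c : Curve F => c 1) :=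
    IsLinearMap.with_bound ⟨fun _ _ => rfl, fun _ _ => rfl⟩ 1
      (fun c => by simpa using c.norm_apply_le 1)
  exact this.contDiff

end Curve

/-- Smooth dependence of an integral over `[0, 1]` on a parameter. -/
lemma contDiffOn_integral {W : Set P} (hW : IsOpen W) {f : P × ℝ → F}
    (hf : ContDiffOn ℝ ∞ f (W ×ˢ univ)) :
    ContDiffOn ℝ ∞ (fun p => ∫ s in (0 : ℝ)..1, f (p, s)) W := by
  obtain ⟨g, hg⟩ := exists_curry hf.continuousOn
  have h1 : ContDiffOn ℝ ∞ (fun p => Curve.primitive F (g p)) W :=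
    (Curve.primitive F).contDiff.comp_contDiffOn (contDiffOn_curry hW hf hg)
  refine (Curve.contDiff_eval_one.comp_contDiffOn h1).congr fun p hp => ?_
  simp only [Function.comp, Curve.primitive_apply]
  refine intervalIntegral.integral_congr fun t ht => ?_
  simp only [zero_le_one, uIcc_of_le] at ht
  simp [hg p hp, projIcc_of_mem zero_le_one ht]

/-- The Volterra operator `g ↦ (s ↦ ∫₀ˢ A g)`. -/
noncomputable def volterra (F : Type) [NormedAddCommGroup F] [NormedSpace ℝ F] :
    Curve (F →L[ℝ] F) →L[ℝ] Curve F →L[ℝ] Curve F :=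
  LinearMap.mkContinuous₂
    (LinearMap.mk₂ ℝ (fun (A : Curve (F →L[ℝ] F)) (g : Curve F) =>
        Curve.primitive F (Curve.mk (fun s => A s (g s)) (by fun_prop)))
      (fun _ _ _ => by rw [← map_add]; congr 1)
      (fun _ _ _ => by rw [← map_smul]; congr 1)
      (fun _ _ _ => by rw [← map_add]; congr 1; ext; simp)
      (fun _ _ _ => by rw [← map_smul]; congr 1; ext; simp)) 1
    (fun A g => by
      rw [one_mul, LinearMap.mk₂_apply]
      refine ((Curve.primitive F).le_of_opNorm_le
        (LinearMap.mkContinuous_norm_le _ zero_le_one _) _).trans ?_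
      rw [one_mul, Curve.norm_le (by positivity)]
      intro s
      exact ((A s).le_opNorm _).trans (mul_le_mul (A.norm_apply_le s) (g.norm_apply_le s)
        (norm_nonneg _) (norm_nonneg _)))

lemma volterra_apply (A : Curve (F →L[ℝ] F)) (g : Curve F) (s : I) :
    volterra F A g s = ∫ t in (0 : ℝ)..s,
      A (projIcc 0 1 zero_le_one t) (g (projIcc 0 1 zero_le_one t)) := rfl

lemma norm_volterra_pow_apply_le (A : Curve (F →L[ℝ] F)) (g : Curve F) (j : ℕ) :
    ∀ s : I, ‖((volterra F A) ^ j) g s‖ ≤ ‖A‖ ^ j * ((s : ℝ) ^ j / j.factorial) * ‖g‖ := by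
  induction j with
  | zero => intro s; simpa using g.norm_apply_le s
  | succ j ih =>
    intro s
    rw [pow_succ', mul_apply_eq_comp, volterra_apply]
    have h := intervalIntegral.norm_integral_le_of_norm_le (a := 0) (b := (s : ℝ))
      (μ := MeasureTheory.volume)
      (f := fun t : ℝ => A (projIcc 0 1 zero_le_one t)
        (((volterra F A) ^ j) g (projIcc 0 1 zero_le_one t)))
      -- Integrating `t ^ j / j!` produces `s ^ (j + 1) / (j + 1)!`, the factor at the next power.
      (g := fun t => ‖A‖ ^ (j + 1) * ‖g‖ / j.factorial * t ^ j) s.2.1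
      (Eventually.of_forall fun t ht => by
        have ht' : t ∈ Icc (0 : ℝ) 1 := ⟨ht.1.le, ht.2.trans s.2.2⟩
        rw [projIcc_of_mem zero_le_one ht']
        refine ((A _).le_opNorm _).trans ((mul_le_mul (A.norm_apply_le _) (ih ⟨t, ht'⟩)
          (norm_nonneg _) (norm_nonneg _)).trans (le_of_eq ?_))
        simp only
        ring)
      (by apply Continuous.intervalIntegrable; fun_prop)
    refine h.trans (le_of_eq ?_)
    rw [intervalIntegral.integral_const_mul, integral_pow, Nat.factorial_succ]
    push_cast
    have h1 : (j : ℝ) + 1 ≠ 0 := by positivity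
    have h2 : (j.factorial : ℝ) ≠ 0 := by positivity
    field_simp
    simp

/-- The factorial bound makes some power `V ^ j` a strict contraction, whatever the size of `A`.
Then `1 - V ^ j` is a unit and factors as `(1 - V) ∑ V ^ i` with commuting factors. -/
lemma isUnit_one_sub_volterra [CompleteSpace F] (A : Curve (F →L[ℝ] F)) :
    IsUnit (1 - volterra F A) := by
  have hlim := FloorSemiring.tendsto_pow_div_factorial_atTop ‖A‖
  obtain ⟨j, hj⟩ := (hlim.eventually (gt_mem_nhds zero_lt_one)).exists
  have hnorm : ‖(volterra F A) ^ j‖ < 1 := by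
    refine lt_of_le_of_lt (ContinuousLinearMap.opNorm_le_bound _ (by positivity) fun g => ?_) hj
    rw [Curve.norm_le (by positivity)]
    intro s
    refine (norm_volterra_pow_apply_le A g j s).trans ?_
    gcongr
    rw [mul_div_assoc', mul_comm, mul_div_assoc]
    exact mul_le_of_le_one_left (by positivity) (pow_le_one₀ s.2.1 s.2.2)
  have h1 : IsUnit (1 - (volterra F A) ^ j) := isUnit_one_sub_of_norm_lt_one hnorm
  have hc : Commute (1 - volterra F A) (∑ i ∈ Finset.range j, (volterra F A) ^ i) :=
    Commute.sum_right _ _ _ fun i _ =>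
      (Commute.one_left _).sub_left ((Commute.refl _).pow_right i)
  have h2 : (1 - volterra F A) * ∑ i ∈ Finset.range j, (volterra F A) ^ i
      = 1 - (volterra F A) ^ j := mul_neg_geom_sum _ _
  exact (hc.isUnit_mul_iff.1 (h2 ▸ h1)).1

end Integral

/-! ### Linear differential equations with parameters. -/

section LinearODE

variable {P F : Type} [NormedAddCommGroup P] [NormedSpace ℝ P] [NormedAddCommGroup F]
  [NormedSpace ℝ F]

/-- The solution of the Volterra equation `z = ∫₀ˢ (A z + B)`. -/
noncomputable def volterraSolution (A : Curve (F →L[ℝ] F)) (B : Curve F) : Curve F :=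
  Ring.inverse (1 - volterra F A) (Curve.primitive F B)

lemma volterraSolution_eq_iff [CompleteSpace F] (A : Curve (F →L[ℝ] F)) (B w : Curve F) :
    w = volterraSolution A B ↔ w = volterra F A w + Curve.primitive F B := by
  have hu := isUnit_one_sub_volterra A
  have h1 := Ring.inverse_mul_cancel _ hu
  have h2 := Ring.mul_inverse_cancel _ hu
  constructor
  · intro hw
    have h3 := DFunLike.congr_fun h2 (Curve.primitive F B)
    rw [mul_apply_eq_comp] at h3
    change (1 - volterra F A) (volterraSolution A B) = Curve.primitive F B at h3
    rw [← hw] at h3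
    rw [← h3]
    simp
  · intro hw
    have h3 := DFunLike.congr_fun h1 w
    rw [mul_apply_eq_comp] at h3
    have h4 : (1 - volterra F A) w = Curve.primitive F B := by
      rw [sub_apply, one_apply_eq_self]
      rw [sub_eq_iff_eq_add', ← hw]
    rw [h4] at h3
    exact h3.symm

lemma volterraSolution_apply [CompleteSpace F] (A : Curve (F →L[ℝ] F)) (B : Curve F) (s : I) :
    volterraSolution A B s = ∫ t in (0 : ℝ)..s,
      (A (projIcc 0 1 zero_le_one t) (volterraSolution A B (projIcc 0 1 zero_le_one t))
        + B (projIcc 0 1 zero_le_one t)) := by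
  have h := (volterraSolution_eq_iff A B _).1 rfl
  have h2 := DFunLike.congr_fun h s
  rw [Curve.add_apply, volterra_apply, Curve.primitive_apply,
    ← intervalIntegral.integral_add] at h2
  · exact h2
  · apply Continuous.intervalIntegrable; fun_prop
  · apply Continuous.intervalIntegrable; fun_prop

lemma eq_volterraSolution [CompleteSpace F] {A : Curve (F →L[ℝ] F)} {B w : Curve F}
    (h : ∀ s : I, w s = ∫ t in (0 : ℝ)..s,
      (A (projIcc 0 1 zero_le_one t) (w (projIcc 0 1 zero_le_one t))
        + B (projIcc 0 1 zero_le_one t))) : w = volterraSolution A B := by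
  rw [volterraSolution_eq_iff]
  ext s
  rw [h s, Curve.add_apply, volterra_apply, Curve.primitive_apply,
    ← intervalIntegral.integral_add]
  · apply Continuous.intervalIntegrable; fun_prop
  · apply Continuous.intervalIntegrable; fun_prop

/-- Slowing time by the factor `s` multiplies the coefficients by `s`; uniqueness for the Volterra
equation identifies the two solutions. -/
lemma volterraSolution_scale [CompleteSpace F] {A A' : Curve (F →L[ℝ] F)} {B B' : Curve F} (s : I)
    (hA : ∀ t : I, A' t = (s : ℝ) • A (s * t)) (hB : ∀ t : I, B' t = (s : ℝ) • B (s * t)) (t : I) :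
    volterraSolution A' B' t = volterraSolution A B (s * t) := by
  have : Curve.mk (fun t : I => volterraSolution A B (s * t)) (by fun_prop)
      = volterraSolution A' B' := by
    apply eq_volterraSolution
    intro r
    rw [Curve.mk_apply, volterraSolution_apply]
    have h1 := intervalIntegral.smul_integral_comp_mul_left (a := 0) (b := (r : ℝ))
      (fun t : ℝ =>
        (A (projIcc 0 1 zero_le_one t) (volterraSolution A B (projIcc 0 1 zero_le_one t))
        + B (projIcc 0 1 zero_le_one t))) (s : ℝ)
    rw [mul_zero] at h1
    rw [show ((s * r : I) : ℝ) = (s : ℝ) * r from rfl, ← h1, ← intervalIntegral.integral_smul]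
    refine intervalIntegral.integral_congr fun t ht => ?_
    rw [uIcc_of_le r.2.1] at ht
    have ht' : t ∈ Icc (0 : ℝ) 1 := ⟨ht.1, ht.2.trans r.2.2⟩
    have hst : (s : ℝ) * t ∈ Icc (0 : ℝ) 1 := (s * (⟨t, ht'⟩ : I)).2
    simp only [projIcc_of_mem zero_le_one ht', projIcc_of_mem zero_le_one hst, hA, hB,
      Curve.mk_apply, smul_add]
    rfl
  rw [← this, Curve.mk_apply]

/-- A linear inhomogeneous differential equation with coefficients depending smoothly on parameters
has a solution with zero initial value, which depends smoothly on time and parameters. -/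
lemma exists_linear_ode [CompleteSpace F] {W : Set P} (hW : IsOpen W) {a : P × ℝ → F →L[ℝ] F}
    {b : P × ℝ → F}
    (ha : ContDiffOn ℝ ∞ a (W ×ˢ univ)) (hb : ContDiffOn ℝ ∞ b (W ×ˢ univ)) :
    ∃ y : P × ℝ → F, ContDiffOn ℝ ∞ y (W ×ˢ univ) ∧ ∀ p ∈ W, y (p, 0) = 0 ∧
      ∀ φ : ℝ, HasDerivAt (fun t => y (p, t)) (a (p, φ) (y (p, φ)) + b (p, φ)) φ := by
  have hWo : IsOpen (W ×ˢ (univ : Set ℝ)) := hW.prod isOpen_univ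
  -- The interval from `0` to `φ` is rescaled to `[0, 1]`, so that the end time `φ` becomes one more
  -- parameter. Evaluation at `1` then gives joint smoothness in `(p, φ)`.
  have hscale : ContDiff ℝ ∞ (fun q : (P × ℝ) × ℝ => (q.1.1, q.2 * q.1.2)) := by fun_prop
  have hmaps : MapsTo (fun q : (P × ℝ) × ℝ => (q.1.1, q.2 * q.1.2))
      ((W ×ˢ univ) ×ˢ univ) (W ×ˢ univ) := fun q hq => ⟨hq.1.1, mem_univ _⟩
  have hA' : ContDiffOn ℝ ∞ (fun q : (P × ℝ) × ℝ => q.1.2 • a (q.1.1, q.2 * q.1.2))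
      ((W ×ˢ univ) ×ˢ univ) :=
    (contDiff_snd.comp contDiff_fst).contDiffOn.smul (ha.comp hscale.contDiffOn hmaps)
  have hB' : ContDiffOn ℝ ∞ (fun q : (P × ℝ) × ℝ => q.1.2 • b (q.1.1, q.2 * q.1.2))
      ((W ×ˢ univ) ×ˢ univ) :=
    (contDiff_snd.comp contDiff_fst).contDiffOn.smul (hb.comp hscale.contDiffOn hmaps)
  obtain ⟨A, hA⟩ := exists_curry hA'.continuousOn
  obtain ⟨B, hB⟩ := exists_curry hB'.continuousOn
  have hAs := contDiffOn_curry hWo hA' hA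
  have hBs := contDiffOn_curry hWo hB' hB
  have hinv : ContDiffOn ℝ ∞ (fun q => Ring.inverse (1 - volterra F (A q))) (W ×ˢ univ) := by
    intro q hq
    obtain ⟨u, hu⟩ := isUnit_one_sub_volterra (A q)
    have h1 : ContDiffAt ℝ ∞ Ring.inverse (1 - volterra F (A q)) :=
      hu ▸ contDiffAt_ringInverse ℝ u
    have h2 : ContDiffWithinAt ℝ ∞ (fun q => 1 - volterra F (A q)) (W ×ˢ univ) q :=
      contDiffWithinAt_const.sub ((volterra F).contDiff.comp_contDiffWithinAt (hAs q hq))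
    exact h1.comp_contDiffWithinAt q h2
  have hZ : ContDiffOn ℝ ∞ (fun q => volterraSolution (A q) (B q)) (W ×ˢ univ) :=
    hinv.clm_apply ((Curve.primitive F).contDiff.comp_contDiffOn hBs)
  set y : P × ℝ → F := fun q => volterraSolution (A q) (B q) 1 with hy
  have hys : ContDiffOn ℝ ∞ y (W ×ˢ univ) := Curve.contDiff_eval_one.comp_contDiffOn hZ
  have hsc : ∀ p ∈ W, ∀ φ : ℝ, ∀ s : I,
      volterraSolution (A (p, φ)) (B (p, φ)) s = y (p, s * φ) := by
    intro p hp φ s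
    have h1 := volterraSolution_scale (A := A (p, φ)) (A' := A (p, s * φ)) (B := B (p, φ))
      (B' := B (p, s * φ)) s
      (fun t => by
        rw [hA _ ⟨hp, mem_univ _⟩, hA _ ⟨hp, mem_univ _⟩]
        simp only [Icc.coe_mul, smul_smul]
        congr 3
        ring)
      (fun t => by
        rw [hB _ ⟨hp, mem_univ _⟩, hB _ ⟨hp, mem_univ _⟩]
        simp only [Icc.coe_mul, smul_smul]
        congr 3
        ring) 1
    rw [mul_one] at h1
    exact h1.symm
  have hint : ∀ p ∈ W, ∀ φ : ℝ, y (p, φ) = ∫ t in (0 : ℝ)..φ, (a (p, t) (y (p, t)) + b (p, t)) := by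
    intro p hp φ
    have h1 := intervalIntegral.smul_integral_comp_mul_right (a := 0) (b := 1)
      (fun t : ℝ => (a (p, t) (y (p, t)) + b (p, t))) φ
    rw [zero_mul, one_mul] at h1
    rw [← h1, hy]
    simp only
    rw [volterraSolution_apply, ← intervalIntegral.integral_smul]
    refine intervalIntegral.integral_congr fun t ht => ?_
    have ht' : t ∈ Icc (0 : ℝ) 1 := by simpa using ht
    simp only [projIcc_of_mem zero_le_one ht']
    rw [hsc p hp, hA _ ⟨hp, mem_univ _⟩, hB _ ⟨hp, mem_univ _⟩]
    simp [smul_add, hy]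
  refine ⟨y, hys, fun p hp => ⟨by rw [hint p hp, intervalIntegral.integral_same], fun φ => ?_⟩⟩
  have hline : Continuous fun t : ℝ => (p, t) := by fun_prop
  have hm : ∀ t : ℝ, (p, t) ∈ W ×ˢ (univ : Set ℝ) := fun t => ⟨hp, mem_univ _⟩
  have hcont : Continuous fun t : ℝ => a (p, t) (y (p, t)) + b (p, t) :=
    ((ha.continuousOn.comp_continuous hline hm).clm_apply
      (hys.continuousOn.comp_continuous hline hm)).add (hb.continuousOn.comp_continuous hline hm)
  have h2 := (hcont.integral_hasStrictDerivAt 0 φ).hasDerivAt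
  refine h2.congr_of_eventuallyEq (Eventually.of_forall fun t => hint p hp t)

/-- Uniqueness for linear differential equations on the line. -/
lemma linear_ode_unique {a : ℝ → F →L[ℝ] F} {b : ℝ → F} (ha : Continuous a) {y z : ℝ → F}
    (hy : ∀ t, HasDerivAt y (a t (y t) + b t) t) (hz : ∀ t, HasDerivAt z (a t (z t) + b t) t)
    {t₀ : ℝ} (h0 : y t₀ = z t₀) : y = z := by
  ext t
  set R := |t| + |t₀| + 1 with hR
  have ht : t ∈ Ioo (-R) R := abs_lt.1 (by rw [hR]; linarith [abs_nonneg t₀])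
  have ht₀ : t₀ ∈ Ioo (-R) R := abs_lt.1 (by rw [hR]; linarith [abs_nonneg t])
  obtain ⟨K, hK⟩ := (isCompact_Icc (a := -R) (b := R)).exists_bound_of_continuousOn
    ha.continuousOn
  refine ODE_solution_unique_of_mem_Ioo (v := fun t x => a t x + b t) (s := fun _ => univ)
    (K := K.toNNReal) (fun s hs => ?_) ht₀ (fun s _ => ⟨hy s, mem_univ _⟩)
    (fun s _ => ⟨hz s, mem_univ _⟩) h0 ht
  apply LipschitzOnWith.of_dist_le_mul
  intro x _ x' _
  rw [dist_add_right, dist_eq_norm, dist_eq_norm, ← map_sub]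
  refine ((a s).le_opNorm _).trans ?_
  gcongr
  exact (hK s (Ioo_subset_Icc_self hs)).trans (Real.le_coe_toNNReal K)

end LinearODE

/-! ### Division of a smooth function by `ε`. -/

section Hadamard

variable {P F : Type} [NormedAddCommGroup P] [NormedSpace ℝ P] [NormedAddCommGroup F]
  [NormedSpace ℝ F]

/-- The quotient `(f p ε - f p 0) / ε`, as an integral that is smooth through `ε = 0`. -/
noncomputable def hadamardQuotient (f : P → ℝ → F) (p : P) (ε : ℝ) : F :=
  ∫ s in (0 : ℝ)..1, deriv (f p) (s * ε)

lemma contDiffOn_deriv_snd {W : Set P} (hW : IsOpen W) {f : P → ℝ → F}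
    (hf : ContDiffOn ℝ ∞ (Function.uncurry f) (W ×ˢ univ)) :
    ContDiffOn ℝ ∞ (fun q : P × ℝ => deriv (f q.1) q.2) (W ×ˢ univ) := by
  have hWo : IsOpen (W ×ˢ (univ : Set ℝ)) := hW.prod isOpen_univ
  have h1 : ContDiffOn ℝ ∞ (fun q => fderiv ℝ (Function.uncurry f) q (0, 1)) (W ×ˢ univ) :=
    (hf.fderiv_of_isOpen hWo (by simp)).clm_apply contDiffOn_const
  refine h1.congr fun q hq => ?_
  have h2 : HasFDerivAt (Function.uncurry f) (fderiv ℝ (Function.uncurry f) q) (q.1, q.2) :=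
    ((hf.differentiableOn (by simp)).differentiableAt (hWo.mem_nhds hq)).hasFDerivAt
  have h3 := h2.comp_hasDerivAt q.2 ((hasDerivAt_const q.2 q.1).prodMk (hasDerivAt_id q.2))
  exact h3.deriv

lemma contDiffOn_hadamardQuotient {W : Set P} (hW : IsOpen W) {f : P → ℝ → F}
    (hf : ContDiffOn ℝ ∞ (Function.uncurry f) (W ×ˢ univ)) :
    ContDiffOn ℝ ∞ (Function.uncurry (hadamardQuotient f)) (W ×ˢ univ) := by
  have hWo : IsOpen (W ×ˢ (univ : Set ℝ)) := hW.prod isOpen_univ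
  refine contDiffOn_integral hWo (f := fun q : (P × ℝ) × ℝ => deriv (f q.1.1) (q.2 * q.1.2)) ?_
  exact (contDiffOn_deriv_snd hW hf).comp
    (f := fun q : (P × ℝ) × ℝ => (q.1.1, q.2 * q.1.2)) (by fun_prop)
    (fun q hq => ⟨hq.1.1, mem_univ _⟩)

omit [NormedAddCommGroup P] [NormedSpace ℝ P] in
lemma smul_hadamardQuotient [CompleteSpace F] {f : P → ℝ → F} {p : P} (hf : ContDiff ℝ 1 (f p))
    (h0 : f p 0 = 0) (ε : ℝ) : ε • hadamardQuotient f p ε = f p ε := by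
  rw [hadamardQuotient, intervalIntegral.smul_integral_comp_mul_right, zero_mul, one_mul,
    intervalIntegral.integral_deriv_eq_sub (fun x _ => (hf.differentiable (by simp)).differentiableAt)
      ((hf.continuous_deriv le_rfl).intervalIntegrable _ _), h0, sub_zero]

omit [NormedAddCommGroup P] [NormedSpace ℝ P] in
lemma hadamardQuotient_zero [CompleteSpace F] (f : P → ℝ → F) (p : P) :
    hadamardQuotient f p 0 = deriv (f p) 0 := by
  simp [hadamardQuotient]

end Hadamard

/-! ### Smooth right inverses. -/

/-- A smooth family of surjective linear maps has a smooth family of right inverses. -/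
lemma exists_smooth_rightInverse {P Q X : Type} [NormedAddCommGroup P] [NormedSpace ℝ P]
    [NormedAddCommGroup Q] [NormedSpace ℝ Q] [FiniteDimensional ℝ Q] [NormedAddCommGroup X]
    [InnerProductSpace ℝ X] [FiniteDimensional ℝ X] {W : Set P} {B : P → Q →L[ℝ] X}
    (hB : ContDiffOn ℝ ∞ B W) (hsurj : ∀ p ∈ W, Function.Surjective (B p)) :
    ∃ S : P → X →L[ℝ] Q, ContDiffOn ℝ ∞ S W ∧ ∀ p ∈ W, ∀ v, B p (S p v) = v := by
  have : CompleteSpace X := FiniteDimensional.complete ℝ X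
  let e := toEuclidean (E := Q)
  -- `Q` is only normed; passing to Euclidean space provides the adjoint for the formula
  -- `B*(BB*)⁻¹`.
  let B' : P → EuclideanSpace ℝ (Fin (Module.finrank ℝ Q)) →L[ℝ] X := fun p =>
    (B p).comp (e.symm : EuclideanSpace ℝ (Fin (Module.finrank ℝ Q)) →L[ℝ] Q)
  have hB' : ContDiffOn ℝ ∞ B' W := hB.clm_comp contDiffOn_const
  have hsurj' : ∀ p ∈ W, Function.Surjective (B' p) := fun p hp =>
    (hsurj p hp).comp e.symm.surjective
  let adj : P → X →L[ℝ] EuclideanSpace ℝ (Fin (Module.finrank ℝ Q)) := fun p =>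
    ContinuousLinearMap.adjoint (B' p)
  have hadj : ContDiffOn ℝ ∞ adj W := by
    have h1 : IsBoundedLinearMap ℝ
        (fun T : EuclideanSpace ℝ (Fin (Module.finrank ℝ Q)) →L[ℝ] X =>
          ContinuousLinearMap.adjoint T) :=
      IsLinearMap.with_bound ⟨fun _ _ => by simp, fun _ _ => by simp⟩ 1 (fun T => by simp)
    exact h1.contDiff.comp_contDiffOn hB'
  let T : P → X →L[ℝ] X := fun p => (B' p).comp (adj p)
  have hT : ContDiffOn ℝ ∞ T W := hB'.clm_comp hadj
  have hunit : ∀ p ∈ W, IsUnit (T p) := by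
    intro p hp
    -- `BB*v = 0` gives `‖B*v‖² = 0`, so `v` is orthogonal to the range of `B`, which is everything.
    have hinj : Function.Injective (T p) := by
      rw [injective_iff_map_eq_zero]
      intro v hv
      have h1 : adj p v = 0 := by
        rw [← inner_self_eq_zero (𝕜 := ℝ), ContinuousLinearMap.adjoint_inner_left]
        change inner ℝ v (T p v) = 0
        rw [hv, inner_zero_right]
      obtain ⟨w, hw⟩ := hsurj' p hp v
      rw [← inner_self_eq_zero (𝕜 := ℝ)]
      nth_rw 2 [← hw]
      rw [← ContinuousLinearMap.adjoint_inner_left]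
      change inner ℝ (adj p v) w = 0
      rw [h1, inner_zero_left]
    rw [ContinuousLinearMap.isUnit_iff_bijective]
    exact ⟨hinj, (LinearMap.injective_iff_surjective (f := (T p).toLinearMap)).1 hinj⟩
  have hinv : ContDiffOn ℝ ∞ (fun p => Ring.inverse (T p)) W := by
    intro p hp
    obtain ⟨u, hu⟩ := hunit p hp
    have h1 : ContDiffAt ℝ ∞ Ring.inverse (T p) := hu ▸ contDiffAt_ringInverse ℝ u
    exact h1.comp_contDiffWithinAt p (hT p hp)
  refine ⟨fun p => (e.symm : EuclideanSpace ℝ (Fin (Module.finrank ℝ Q)) →L[ℝ] Q).comp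
    ((adj p).comp (Ring.inverse (T p))), contDiffOn_const.clm_comp (hadj.clm_comp hinv), ?_⟩
  intro p hp v
  have h1 := DFunLike.congr_fun (Ring.mul_inverse_cancel _ (hunit p hp)) v
  exact h1

/-! ### Exponential dichotomy and the monodromy operator. -/

section Monodromy

variable {n : ℕ}

/-- On the sum of the stable and the unstable subspace, the monodromy operator minus the identity
is invertible. -/
lemma exists_monodromy_sub_eq {F₀ : E n → E n} {γ : ℝ → E n} {T : ℝ} (hT : 0 < T)
    (hγ : Function.Periodic γ T) (hcont : Continuous fun t => fderiv ℝ F₀ (γ t))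
    {Ns Nu : Submodule ℝ (E n)} (hdisj : Disjoint Ns Nu) {Y : ℝ → E n →L[ℝ] E n} (hY0 : Y 0 = 1)
    (hY : ∀ c, IsVariationalSolution F₀ γ fun t => Y t c)
    (hNs : ∀ c ∈ Ns, Y T c ∈ Ns) (hNu : ∀ c ∈ Nu, Y T c ∈ Nu) {K lam : ℝ} (hlam : 0 < lam)
    (hKs : ∀ c ∈ Ns, ∀ t, 0 ≤ t → ‖Y t c‖ ≤ K * Real.exp (-lam * t) * ‖c‖)
    (hKu : ∀ c ∈ Nu, ∀ t, t ≤ 0 → ‖Y t c‖ ≤ K * Real.exp (lam * t) * ‖c‖)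
    {v : E n} (hv : v ∈ Ns ⊔ Nu) : ∃ c, Y T c - c = v := by
  have hper : ∀ c, Y T c = c → Function.Periodic (fun t => Y t c) T := by
    intro c hc
    have h1 : (fun t => Y (t + T) c) = fun t => Y t c :=
      linear_ode_unique (a := fun t => fderiv ℝ F₀ (γ t)) (b := fun _ => 0) hcont (t₀ := 0)
        (fun t => by
          have := (hY c (t + T)).comp_add_const t T
          rw [hγ t] at this
          simpa using this)
        (fun t => by simpa using hY c t) (by simp [hc, hY0])
    exact fun t => congr_fun h1 t
  have hlim : Tendsto (fun j : ℕ => K * Real.exp (-lam * (j * T))) atTop (𝓝 0) := by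
    have h1 : Tendsto (fun j : ℕ => (lam * T) * (j : ℝ)) atTop atTop :=
      tendsto_natCast_atTop_atTop.const_mul_atTop (mul_pos hlam hT)
    have h2 := (Real.tendsto_exp_neg_atTop_nhds_zero.comp h1).const_mul K
    rw [mul_zero] at h2
    refine h2.congr fun j => ?_
    simp only [Function.comp]
    ring_nf
  have hzero : ∀ c : E n, (∀ j : ℕ, ‖c‖ ≤ K * Real.exp (-lam * (j * T)) * ‖c‖) → c = 0 := by
    intro c hc
    have h1 := ge_of_tendsto' (hlim.mul_const ‖c‖) hc
    simpa using h1
  -- A fixed vector returns unchanged at all multiples of `T`, while the dichotomy bound tends to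
  -- `0` there: forward in time for `Ns`, backward for `Nu`.
  have hs : ∀ c ∈ Ns, Y T c = c → c = 0 := by
    intro c hc hcT
    refine hzero c fun j => ?_
    have h1 := (hper c hcT).nat_mul j 0
    simp only [zero_add, hY0, one_apply_eq_self] at h1
    have h2 := hKs c hc (j * T) (by positivity)
    rwa [h1] at h2
  have hu : ∀ c ∈ Nu, Y T c = c → c = 0 := by
    intro c hc hcT
    refine hzero c fun j => ?_
    have h1 := (hper c hcT).sub_nat_mul_eq j (x := 0)
    simp only [zero_sub, hY0, one_apply_eq_self] at h1
    have h2 := hKu c hc (-(j * T)) (by simp only [Left.neg_nonpos_iff]; positivity)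
    rw [h1] at h2
    rwa [neg_mul, ← mul_neg]
  let L : E n →ₗ[ℝ] E n := ((Y T) - 1 : E n →L[ℝ] E n).toLinearMap
  have hL : ∀ c, L c = Y T c - c := fun c => rfl
  have hmaps : ∀ c ∈ Ns ⊔ Nu, L c ∈ Ns ⊔ Nu := by
    intro c hc
    obtain ⟨a, ha, b, hb, rfl⟩ := Submodule.mem_sup.1 hc
    rw [map_add]
    exact Submodule.add_mem_sup (Ns.sub_mem (hNs a ha) ha) (Nu.sub_mem (hNu b hb) hb)
  -- If `L (a + b) = 0`, then `L a = -L b` lies in both subspaces and vanishes. In finite dimension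
  -- injectivity on the invariant sum gives surjectivity.
  have hinj : Function.Injective (L.restrict hmaps) := by
    rw [injective_iff_map_eq_zero]
    rintro ⟨c, hc⟩ h0
    have h1 : L c = 0 := congr_arg Subtype.val h0
    obtain ⟨a, ha, b, hb, rfl⟩ := Submodule.mem_sup.1 hc
    rw [map_add] at h1
    have h2 : L a ∈ Ns := Ns.sub_mem (hNs a ha) ha
    have h3 : L b ∈ Nu := Nu.sub_mem (hNu b hb) hb
    have h4 : L a = 0 := by
      refine Submodule.disjoint_def.1 hdisj _ h2 ?_
      rw [eq_neg_of_add_eq_zero_left h1]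
      exact Nu.neg_mem h3
    have h5 : L b = 0 := by rwa [h4, zero_add] at h1
    have h6 := hs a ha (sub_eq_zero.1 h4)
    have h7 := hu b hb (sub_eq_zero.1 h5)
    simp [h6, h7]
  obtain ⟨c, hc⟩ := LinearMap.injective_iff_surjective.1 hinj ⟨v, hv⟩
  exact ⟨c, congr_arg Subtype.val hc⟩

end Monodromy

/-! ### The homological equation along the periodic orbits. -/

section PeriodicOrbits

variable {k n : ℕ} {F₀ : E n → E n} {U : Set (E k)} {γ₀ : E k → ℝ → E n} {τ : E k → ℝ}

lemma fderiv_add_phase {G : E k × ℝ → E n} (hU : IsOpen U) {T : ℝ}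
    (hper : ∀ x ∈ U, ∀ φ, G (x, φ + T) = G (x, φ)) {x : E k} (hx : x ∈ U) (φ : ℝ) :
    fderiv ℝ G (x, φ + T) = fderiv ℝ G (x, φ) := by
  have h1 : (fun p : E k × ℝ => G (p + (0, T))) =ᶠ[𝓝 (x, φ)] G := by
    filter_upwards [(hU.prod isOpen_univ).mem_nhds (⟨hx, mem_univ φ⟩ : (x, φ) ∈ U ×ˢ univ)]
      with p hp
    change G (p.1 + 0, p.2 + T) = G p
    rw [add_zero]
    exact hper p.1 hp.1 p.2
  rw [← h1.fderiv_eq, fderiv_comp_add_right]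
  simp

namespace IsPeriodicOrbitFamily

lemma freq_pos (h : IsPeriodicOrbitFamily F₀ U γ₀ τ) {x : E k} (hx : x ∈ U) : 0 < freq τ x :=
  div_pos (by positivity) (h.period_pos x hx)

lemma contDiffOn_freq (h : IsPeriodicOrbitFamily F₀ U γ₀ τ) : ContDiffOn ℝ ∞ (freq τ) U :=
  contDiffOn_const.div h.period_smooth fun x hx => (h.period_pos x hx).ne'

lemma contDiffOn_inv_freq (h : IsPeriodicOrbitFamily F₀ U γ₀ τ) :
    ContDiffOn ℝ ∞ (fun x => (freq τ x)⁻¹) U :=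
  h.contDiffOn_freq.inv fun _ hx => (h.freq_pos hx).ne'

lemma freq_mul_period (h : IsPeriodicOrbitFamily F₀ U γ₀ τ) {x : E k} (hx : x ∈ U) :
    freq τ x * τ x = 2 * Real.pi :=
  div_mul_cancel₀ _ (h.period_pos x hx).ne'

lemma phaseParam_freq_mul (h : IsPeriodicOrbitFamily F₀ U γ₀ τ) {x : E k} (hx : x ∈ U) (t : ℝ) :
    phaseParam γ₀ τ x (freq τ x * t) = γ₀ x t := by
  rw [phaseParam, mul_div_cancel_left₀ _ (h.freq_pos hx).ne']

lemma phaseParam_periodic (h : IsPeriodicOrbitFamily F₀ U γ₀ τ) {x : E k} (hx : x ∈ U) :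
    Function.Periodic (phaseParam γ₀ τ x) (2 * Real.pi) := by
  intro φ
  have h1 := (h.freq_pos hx).ne'
  rw [phaseParam, phaseParam, ← h.freq_mul_period hx, add_div, mul_div_cancel_left₀ _ h1,
    h.periodic x hx]

lemma hasDerivAt_phaseParam (h : IsPeriodicOrbitFamily F₀ U γ₀ τ) {x : E k} (hx : x ∈ U) (φ : ℝ) :
    HasDerivAt (phaseParam γ₀ τ x) ((freq τ x)⁻¹ • F₀ (phaseParam γ₀ τ x φ)) φ := by
  have h1 := (h.solution x hx (φ / freq τ x)).scomp φ ((hasDerivAt_id φ).div_const (freq τ x))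
  rw [one_div] at h1
  exact h1

lemma hasFDerivAt_phaseParam (h : IsPeriodicOrbitFamily F₀ U γ₀ τ) {x : E k} (hx : x ∈ U)
    (φ : ℝ) : HasFDerivAt (fun p : E k × ℝ => phaseParam γ₀ τ p.1 p.2)
      (fderiv ℝ (fun p : E k × ℝ => phaseParam γ₀ τ p.1 p.2) (x, φ)) (x, φ) :=
  ((h.embedding.smooth.differentiableOn (by simp)).differentiableAt
    ((h.isOpen.prod isOpen_univ).mem_nhds ⟨hx, mem_univ φ⟩)).hasFDerivAt

lemma fderiv_phaseParam_phase (h : IsPeriodicOrbitFamily F₀ U γ₀ τ) {x : E k} (hx : x ∈ U)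
    (φ : ℝ) : fderiv ℝ (fun p : E k × ℝ => phaseParam γ₀ τ p.1 p.2) (x, φ) (0, 1) =
      (freq τ x)⁻¹ • F₀ (phaseParam γ₀ τ x φ) := by
  have h3 := (h.hasFDerivAt_phaseParam hx φ).comp_hasDerivAt φ
    ((hasDerivAt_const φ x).prodMk (hasDerivAt_id φ))
  exact h3.unique (h.hasDerivAt_phaseParam hx φ)

lemma contDiffOn_fderiv_phaseParam (h : IsPeriodicOrbitFamily F₀ U γ₀ τ) :
    ContDiffOn ℝ ∞ (fderiv ℝ (fun p : E k × ℝ => phaseParam γ₀ τ p.1 p.2)) (U ×ˢ univ) :=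
  h.embedding.smooth.fderiv_of_isOpen (h.isOpen.prod isOpen_univ) (by simp)

/-- The derivative of the parametrisation of the orbits solves the variational equation up to a
term that comes from the variation of the frequency. -/
lemma hasDerivAt_fderiv_phaseParam (h : IsPeriodicOrbitFamily F₀ U γ₀ τ)
    (hF₀ : ContDiff ℝ ∞ F₀) {x : E k} (hx : x ∈ U) (φ : ℝ) (v : E k × ℝ) :
    HasDerivAt (fun t => fderiv ℝ (fun p : E k × ℝ => phaseParam γ₀ τ p.1 p.2) (x, t) v)
      ((freq τ x)⁻¹ • fderiv ℝ F₀ (phaseParam γ₀ τ x φ)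
          (fderiv ℝ (fun p : E k × ℝ => phaseParam γ₀ τ p.1 p.2) (x, φ) v) +
        fderiv ℝ (fun x => (freq τ x)⁻¹) x v.1 • F₀ (phaseParam γ₀ τ x φ)) φ := by
  set G : E k × ℝ → E n := fun p => phaseParam γ₀ τ p.1 p.2 with hG
  have hWo : IsOpen (U ×ˢ (univ : Set ℝ)) := h.isOpen.prod isOpen_univ
  have hW : U ×ˢ (univ : Set ℝ) ∈ 𝓝 (x, φ) := hWo.mem_nhds ⟨hx, mem_univ φ⟩
  have hD : HasFDerivAt (fderiv ℝ G) (fderiv ℝ (fderiv ℝ G) (x, φ)) (x, φ) :=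
    ((h.contDiffOn_fderiv_phaseParam.differentiableOn (by simp)).differentiableAt hW).hasFDerivAt
  have h1 : HasDerivAt (fun t => fderiv ℝ G (x, t) v)
      (fderiv ℝ (fderiv ℝ G) (x, φ) (0, 1) v) φ := by
    have h2 := hD.comp_hasDerivAt φ ((hasDerivAt_const φ x).prodMk (hasDerivAt_id φ))
    have h3 := h2.clm_apply (hasDerivAt_const φ v)
    simpa using h3
  -- Symmetry of the second derivative reduces the claim to differentiating `∂_φ Γ₀ = ω⁻¹ F₀(Γ₀)` in
  -- the direction `v`; `ω⁻¹` depends on `x`, hence the second term.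
  have hsymm : fderiv ℝ (fderiv ℝ G) (x, φ) (0, 1) v = fderiv ℝ (fderiv ℝ G) (x, φ) v (0, 1) :=
    ((h.embedding.smooth.contDiffAt hW).isSymmSndFDerivAt
      (by rw [minSmoothness_of_isRCLikeNormedField]; exact WithTop.coe_le_coe.2 (le_top (a := (2 : ℕ∞))))).eq _ _
  have h4 : HasFDerivAt (fun q => fderiv ℝ G q (0, 1))
      ((fderiv ℝ (fderiv ℝ G) (x, φ)).flip (0, 1)) (x, φ) := by
    have h3 := hD.clm_apply (hasFDerivAt_const ((0 : E k), (1 : ℝ)) (x, φ))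
    simpa using h3
  have hσ : HasFDerivAt (fun q : E k × ℝ => (freq τ q.1)⁻¹)
      ((fderiv ℝ (fun x => (freq τ x)⁻¹) x).comp (ContinuousLinearMap.fst ℝ (E k) ℝ)) (x, φ) := by
    have h5 : HasFDerivAt (fun x => (freq τ x)⁻¹) (fderiv ℝ (fun x => (freq τ x)⁻¹) x)
        ((x, φ) : E k × ℝ).1 :=
      ((h.contDiffOn_inv_freq.differentiableOn (by simp)).differentiableAt
        (h.isOpen.mem_nhds hx)).hasFDerivAt
    exact h5.comp (x, φ) hasFDerivAt_fst
  have hFG : HasFDerivAt (fun q : E k × ℝ => F₀ (G q))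
      ((fderiv ℝ F₀ (G (x, φ))).comp (fderiv ℝ G (x, φ))) (x, φ) :=
    ((hF₀.differentiable (by simp)).differentiableAt.hasFDerivAt (x := G (x, φ))).comp (x, φ)
      (h.hasFDerivAt_phaseParam hx φ)
  have h6 := hσ.smul hFG
  have h7 : (fun q : E k × ℝ => (freq τ q.1)⁻¹ • F₀ (G q)) =ᶠ[𝓝 (x, φ)]
      fun q => fderiv ℝ G q (0, 1) := by
    filter_upwards [hW] with q hq
    exact (h.fderiv_phaseParam_phase hq.1 q.2).symm
  have h8 := DFunLike.congr_fun ((h6.congr_of_eventuallyEq h7.symm).unique h4) v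
  rw [hsymm] at h1
  have h9 : fderiv ℝ (fderiv ℝ G) (x, φ) v (0, 1) = (freq τ x)⁻¹ • fderiv ℝ F₀ (G (x, φ))
          (fderiv ℝ G (x, φ) v) +
        fderiv ℝ (fun x => (freq τ x)⁻¹) x v.1 • F₀ (G (x, φ)) := by
    have := h8.symm
    simpa using this
  rw [h9] at h1
  exact h1

end IsPeriodicOrbitFamily

/-- The solution operator of `y' = ω⁻¹ (DF₀ y + DΓ₀ ρ)`: it maps `(y(0), ρ)` to `y(φ) - y(0)`. -/
lemma exists_solution_operator (h : IsPeriodicOrbitFamily F₀ U γ₀ τ) (hF₀ : ContDiff ℝ ∞ F₀) :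
    ∃ u : E k × ℝ → (E n × (E k × ℝ)) →L[ℝ] E n, ContDiffOn ℝ ∞ u (U ×ˢ univ) ∧
      ∀ x ∈ U, u (x, 0) = 0 ∧ ∀ (c : E n) (ρ : E k × ℝ) (φ : ℝ),
        HasDerivAt (fun t => u (x, t) (c, ρ) + c)
          ((freq τ x)⁻¹ • (fderiv ℝ F₀ (phaseParam γ₀ τ x φ) (u (x, φ) (c, ρ) + c) +
            fderiv ℝ (fun p : E k × ℝ => phaseParam γ₀ τ p.1 p.2) (x, φ) ρ)) φ := by
  have hσ : ContDiffOn ℝ ∞ (fun p : E k × ℝ => (freq τ p.1)⁻¹) (U ×ˢ univ) :=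
    h.contDiffOn_inv_freq.comp contDiffOn_fst fun p hp => hp.1
  have hDF : ContDiff ℝ ∞ (fderiv ℝ F₀) := hF₀.fderiv_right (by simp)
  have ha : ContDiffOn ℝ ∞ (fun p : E k × ℝ =>
      (freq τ p.1)⁻¹ • fderiv ℝ F₀ (phaseParam γ₀ τ p.1 p.2)) (U ×ˢ univ) :=
    hσ.smul (hDF.comp_contDiffOn h.embedding.smooth)
  obtain ⟨u, hu, hu'⟩ := exists_linear_ode (P := E k) (F := (E n × (E k × ℝ)) →L[ℝ] E n) h.isOpen
    (a := fun p => ContinuousLinearMap.compL ℝ (E n × (E k × ℝ)) (E n) (E n)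
      ((freq τ p.1)⁻¹ • fderiv ℝ F₀ (phaseParam γ₀ τ p.1 p.2)))
    (b := fun p => ((freq τ p.1)⁻¹ • fderiv ℝ F₀ (phaseParam γ₀ τ p.1 p.2)).comp
        (ContinuousLinearMap.fst ℝ (E n) (E k × ℝ)) +
      (freq τ p.1)⁻¹ • (fderiv ℝ (fun p : E k × ℝ => phaseParam γ₀ τ p.1 p.2) p).comp
        (ContinuousLinearMap.snd ℝ (E n) (E k × ℝ)))
    ((ContinuousLinearMap.contDiff _).comp_contDiffOn ha)
    ((ha.clm_comp contDiffOn_const).add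
      (hσ.smul (h.contDiffOn_fderiv_phaseParam.clm_comp contDiffOn_const)))
  refine ⟨u, hu, fun x hx => ⟨(hu' x hx).1, fun c ρ φ => ?_⟩⟩
  have h1 := (((hu' x hx).2 φ).clm_apply (hasDerivAt_const φ (c, ρ))).add_const c
  refine h1.congr_deriv ?_
  simp [smul_add, add_assoc]

lemma continuous_coefficient (h : IsPeriodicOrbitFamily F₀ U γ₀ τ) (hF₀ : ContDiff ℝ ∞ F₀)
    {x : E k} (hx : x ∈ U) :
    Continuous fun φ => (freq τ x)⁻¹ • fderiv ℝ F₀ (phaseParam γ₀ τ x φ) := by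
  have h1 : Continuous (phaseParam γ₀ τ x) := continuous_iff_continuousAt.2 fun φ =>
    (h.hasDerivAt_phaseParam hx φ).continuousAt
  have hDF : Continuous (fderiv ℝ F₀) := (hF₀.fderiv_right (m := ∞) (by simp)).continuous
  exact (hDF.comp h1).const_smul (freq τ x)⁻¹

/-- Normal hyperbolicity makes the solvability condition of the homological equation surjective:
the monodromy operator minus the identity covers the normal directions, the free parameters `ρ` the
tangential ones. -/
lemma surjective_solution_operator (h : IsPeriodicOrbitFamily F₀ U γ₀ τ)
    (hhyp : IsNormallyHyperbolic F₀ U γ₀ τ) (hF₀ : ContDiff ℝ ∞ F₀)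
    {u : E k × ℝ → (E n × (E k × ℝ)) →L[ℝ] E n} {x : E k} (hx : x ∈ U) (hu0 : u (x, 0) = 0)
    (hu : ∀ (c : E n) (ρ : E k × ℝ) (φ : ℝ),
        HasDerivAt (fun t => u (x, t) (c, ρ) + c)
          ((freq τ x)⁻¹ • (fderiv ℝ F₀ (phaseParam γ₀ τ x φ) (u (x, φ) (c, ρ) + c) +
            fderiv ℝ (fun p : E k × ℝ => phaseParam γ₀ τ p.1 p.2) (x, φ) ρ)) φ) :
    Function.Surjective (u (x, 2 * Real.pi)) := by
  obtain ⟨Ns, Nu, lam, hlam, H⟩ := hhyp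
  obtain ⟨hsplit, hinv, K, -, hK⟩ := H x hx
  set G : E k × ℝ → E n := fun p => phaseParam γ₀ τ p.1 p.2 with hG
  set ν := freq τ x with hν
  have hνpos : 0 < ν := h.freq_pos hx
  have hGper : fderiv ℝ G (x, 2 * Real.pi) = fderiv ℝ G (x, 0) := by
    have := fderiv_add_phase (G := G) h.isOpen
      (fun x hx φ => h.phaseParam_periodic hx φ) hx 0
    rwa [zero_add] at this
  have hγ0 : γ₀ x (τ x) = γ₀ x 0 := by simpa using h.periodic x hx 0
  -- the normal directions
  have hnormal : ∀ v ∈ Ns (γ₀ x 0) ⊔ Nu (γ₀ x 0), ∃ q, u (x, 2 * Real.pi) q = v := by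
    -- The transition operator in the original time: `u` records `y(φ) - y(0)`, so the identity is
    -- added back.
    let Y : ℝ → E n →L[ℝ] E n := fun t =>
      (u (x, ν * t)).comp (ContinuousLinearMap.inl ℝ (E n) (E k × ℝ)) + 1
    have hYa : ∀ t c, Y t c = u (x, ν * t) (c, 0) + c := fun t c => by simp [Y]
    have hY0 : Y 0 = 1 := by
      ext1 c
      rw [hYa, mul_zero, hu0]
      simp
    have hY : ∀ c, IsVariationalSolution F₀ (γ₀ x) fun t => Y t c := by
      intro c t
      have h1 := (hu c 0 (ν * t)).scomp t ((hasDerivAt_id t).const_mul ν)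
      simp only [hYa]
      refine h1.congr_deriv ?_
      rw [h.phaseParam_freq_mul hx, map_zero, add_zero, smul_smul, mul_one,
        mul_inv_cancel₀ hνpos.ne', one_smul]
    have hDF : Continuous (fderiv ℝ F₀) := (hF₀.fderiv_right (m := ∞) (by simp)).continuous
    have hγc : Continuous (γ₀ x) := continuous_iff_continuousAt.2 fun t =>
      (h.solution x hx t).continuousAt
    intro v hv
    obtain ⟨c, hc⟩ := exists_monodromy_sub_eq (F₀ := F₀) (γ := γ₀ x) (h.period_pos x hx)
      (h.periodic x hx) (hDF.comp hγc) (hsplit 0).1 hY0 hY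
      (fun c hc => by
        have := (hinv _ (hY c) 0 (τ x)).1 (by simpa [hY0] using hc)
        rwa [hγ0] at this)
      (fun c hc => by
        have := (hinv _ (hY c) 0 (τ x)).2 (by simpa [hY0] using hc)
        rwa [hγ0] at this) hlam
      (fun c hc t ht => by
        have := (hK _ (hY c) 0 t).1 (by simpa [hY0] using hc) ht
        simpa [hY0] using this)
      (fun c hc t ht => by
        have := (hK _ (hY c) 0 t).2 (by simpa [hY0] using hc) ht
        simpa [hY0] using this) hv
    refine ⟨(c, 0), ?_⟩
    rw [← hc, hYa, h.freq_mul_period hx, add_sub_cancel_right]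
  -- the tangential directions
  have htangent : ∀ w : E k × ℝ, ∃ q, u (x, 2 * Real.pi) q = fderiv ℝ G (x, 0) w := by
    intro w
    set κ : ℝ := ν * fderiv ℝ (fun x => (freq τ x)⁻¹) x w.1 with hκ
    -- With forcing `DΓ₀ ρ`, the solution vanishing at `0` is `φ DΓ₀ ρ - (φ²/2) κ' ∂_φ Γ₀`, where
    -- the second term cancels the frequency contribution. At `2π` it equals `DΓ₀ (2π ρ - 2π² κ' (0,
    -- 1))`; this `ρ` makes the argument `w`. The phase component of `ρ` does not affect `κ'`.
    set ρ : E k × ℝ := (2 * Real.pi)⁻¹ • w + (Real.pi * ((2 * Real.pi)⁻¹ * κ)) • (0, 1) with hρ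
    set κ' : ℝ := (2 * Real.pi)⁻¹ * κ with hκ'
    have hpi : (2 * Real.pi) ≠ 0 := by positivity
    have hρ1 : ν * fderiv ℝ (fun x => (freq τ x)⁻¹) x ρ.1 = κ' := by
      rw [hρ, hκ', hκ]
      simp
      ring
    let y : ℝ → E n := fun φ => φ • fderiv ℝ G (x, φ) ρ - (φ ^ 2 / 2 * κ') • fderiv ℝ G (x, φ) (0, 1)
    have hy : ∀ φ, HasDerivAt y (ν⁻¹ • fderiv ℝ F₀ (phaseParam γ₀ τ x φ) (y φ) +
        fderiv ℝ G (x, φ) ρ) φ := by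
      intro φ
      have h1 := (hasDerivAt_id φ).smul (h.hasDerivAt_fderiv_phaseParam hF₀ hx φ ρ)
      have h2 := (((hasDerivAt_pow 2 φ).div_const 2).mul_const κ').smul
        (h.hasDerivAt_fderiv_phaseParam hF₀ hx φ (0, 1))
      refine (h1.sub h2).congr_deriv ?_
      have h3 : fderiv ℝ (fun x => (freq τ x)⁻¹) x ρ.1 • F₀ (phaseParam γ₀ τ x φ) =
          κ' • fderiv ℝ G (x, φ) (0, 1) := by
        rw [h.fderiv_phaseParam_phase hx φ, smul_smul, ← hρ1, mul_comm ν, mul_assoc,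
          mul_inv_cancel₀ hνpos.ne', mul_one]
      rw [h3]
      simp only [y, map_sub, map_smul, map_zero, zero_smul, add_zero, id, ← hG, ← hν]
      module
    have hy0 : y 0 = 0 := by simp [y]
    have heq : y = fun t => u (x, t) (0, ν • ρ) + 0 :=
      linear_ode_unique (a := fun φ => ν⁻¹ • fderiv ℝ F₀ (phaseParam γ₀ τ x φ))
        (b := fun φ => fderiv ℝ G (x, φ) ρ) (continuous_coefficient h hF₀ hx) (t₀ := 0) hy
        (fun φ => by
          refine (hu 0 (ν • ρ) φ).congr_deriv ?_
          rw [map_smul, smul_add, smul_smul, inv_mul_cancel₀ hνpos.ne', one_smul]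
          rfl)
        (by simp [hy0, hu0])
    refine ⟨(0, ν • ρ), ?_⟩
    have h1 := congr_fun heq (2 * Real.pi)
    rw [add_zero] at h1
    rw [← h1]
    simp only [y]
    rw [hGper, ← map_smul, ← map_smul, ← map_sub]
    congr 1
    rw [hρ, smul_add, smul_smul, mul_inv_cancel₀ hpi, one_smul, add_sub_assoc, smul_smul,
      ← sub_smul]
    have : 2 * Real.pi * (Real.pi * κ') - (2 * Real.pi) ^ 2 / 2 * κ' = 0 := by ring
    rw [this, zero_smul, add_zero]
  intro v
  have htop := (hsplit 0).2.sup_eq_top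
  obtain ⟨a, ha, b, hb, rfl⟩ := Submodule.mem_sup.1 (htop ▸ Submodule.mem_top (x := v))
  rw [mul_zero] at ha
  obtain ⟨w, hw⟩ := ha
  obtain ⟨q₁, hq₁⟩ := htangent w
  obtain ⟨q₂, hq₂⟩ := hnormal b hb
  refine ⟨q₁ + q₂, ?_⟩
  rw [map_add, hq₁, hq₂, ← hw]
  rfl

/-- The homological equation
`ω ∂_φ Γ = DF₀(Γ₀) Γ + g - DΓ₀ r` has a smooth solution `Γ`, `2π`-periodic in `φ`, together with
smooth parameters `r`. -/
lemma exists_homological_solution (h : IsPeriodicOrbitFamily F₀ U γ₀ τ)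
    (hhyp : IsNormallyHyperbolic F₀ U γ₀ τ) (hF₀ : ContDiff ℝ ∞ F₀) {g : E k × ℝ → E n}
    (hg : ContDiffOn ℝ ∞ g (U ×ˢ univ))
    (hgper : ∀ x ∈ U, ∀ φ, g (x, φ + 2 * Real.pi) = g (x, φ)) :
    ∃ (r : E k → E k × ℝ) (Γ : E k × ℝ → E n), ContDiffOn ℝ ∞ r U ∧
      ContDiffOn ℝ ∞ Γ (U ×ˢ univ) ∧ ∀ x ∈ U, ∀ φ, Γ (x, φ + 2 * Real.pi) = Γ (x, φ) ∧
        fderiv ℝ Γ (x, φ) (0, freq τ x) = fderiv ℝ F₀ (phaseParam γ₀ τ x φ) (Γ (x, φ)) + g (x, φ) -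
          fderiv ℝ (fun p : E k × ℝ => phaseParam γ₀ τ p.1 p.2) (x, φ) (r x) := by
  set G : E k × ℝ → E n := fun p => phaseParam γ₀ τ p.1 p.2 with hG
  have hσ : ContDiffOn ℝ ∞ (fun p : E k × ℝ => (freq τ p.1)⁻¹) (U ×ˢ univ) :=
    h.contDiffOn_inv_freq.comp contDiffOn_fst fun p hp => hp.1
  have hDF : ContDiff ℝ ∞ (fderiv ℝ F₀) := hF₀.fderiv_right (by simp)
  have ha : ContDiffOn ℝ ∞ (fun p : E k × ℝ =>
      (freq τ p.1)⁻¹ • fderiv ℝ F₀ (phaseParam γ₀ τ p.1 p.2)) (U ×ˢ univ) :=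
    hσ.smul (hDF.comp_contDiffOn h.embedding.smooth)
  obtain ⟨u, hu, hu'⟩ := exists_solution_operator h hF₀
  obtain ⟨y, hy, hy'⟩ := exists_linear_ode h.isOpen ha
    (b := fun p => (freq τ p.1)⁻¹ • g p) (hσ.smul hg)
  have hend : ContDiff ℝ ∞ (fun x : E k => (x, 2 * Real.pi)) := by fun_prop
  have hmaps : MapsTo (fun x : E k => (x, 2 * Real.pi)) U (U ×ˢ univ) :=
    fun x hx => ⟨hx, mem_univ _⟩
  obtain ⟨S, hS, hS'⟩ := exists_smooth_rightInverse (hu.comp hend.contDiffOn hmaps)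
    (fun x hx => surjective_solution_operator h hhyp hF₀ hx (hu' x hx).1 (hu' x hx).2)
  -- `y` is the particular solution starting at `0`. This choice of initial value and parameters
  -- cancels its increment over one period, so that `Γ` closes up.
  set q : E k → E n × (E k × ℝ) := fun x => - S x (y (x, 2 * Real.pi)) with hq
  have hqs : ContDiffOn ℝ ∞ q U := (hS.clm_apply (hy.comp hend.contDiffOn hmaps)).neg
  have hq' : ContDiffOn ℝ ∞ (fun p : E k × ℝ => q p.1) (U ×ˢ univ) :=
    hqs.comp contDiffOn_fst fun p hp => hp.1
  set Γ : E k × ℝ → E n := fun p => y p + (u p (q p.1) + (q p.1).1) with hΓ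
  have hΓs : ContDiffOn ℝ ∞ Γ (U ×ˢ univ) :=
    hy.add ((hu.clm_apply hq').add (contDiff_fst.comp_contDiffOn hq'))
  have hΓ' : ∀ x ∈ U, ∀ φ, HasDerivAt (fun t => Γ (x, t))
      (((freq τ x)⁻¹ • fderiv ℝ F₀ (phaseParam γ₀ τ x φ)) (Γ (x, φ)) +
        (freq τ x)⁻¹ • (g (x, φ) + fderiv ℝ G (x, φ) (q x).2)) φ := by
    intro x hx φ
    refine (((hy' x hx).2 φ).add ((hu' x hx).2 (q x).1 (q x).2 φ)).congr_deriv ?_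
    simp only [hΓ, map_add, Prod.mk.eta, smul_apply, smul_add]
    module
  refine ⟨fun x => -(q x).2, Γ, (contDiff_snd.comp_contDiffOn hqs).neg, hΓs,
    fun x hx φ => ⟨?_, ?_⟩⟩
  -- The coefficients are periodic, so the shifted function solves the same equation; equality at `t
  -- = 0` suffices.
  · have h1 : (fun t => Γ (x, t + 2 * Real.pi)) = fun t => Γ (x, t) := by
      refine linear_ode_unique
        (a := fun φ => (freq τ x)⁻¹ • fderiv ℝ F₀ (phaseParam γ₀ τ x φ))
        (b := fun φ => (freq τ x)⁻¹ • (g (x, φ) + fderiv ℝ G (x, φ) (q x).2))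
        (continuous_coefficient h hF₀ hx) (t₀ := 0)
        (fun t => ?_) (hΓ' x hx) ?_
      · have h2 := (hΓ' x hx (t + 2 * Real.pi)).comp_add_const t (2 * Real.pi)
        rw [h.phaseParam_periodic hx, hgper x hx, fderiv_add_phase (G := G) h.isOpen
          (fun x hx φ => h.phaseParam_periodic hx φ) hx] at h2
        exact h2
      · have h3 := hS' x hx (y (x, 2 * Real.pi))
        simp only [Function.comp] at h3
        simp only [zero_add, hΓ, (hy' x hx).1, (hu' x hx).1, hq, map_neg, h3]
        simp
    exact congr_fun h1 φ
  · have h1 : HasFDerivAt Γ (fderiv ℝ Γ (x, φ)) (x, φ) :=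
      ((hΓs.differentiableOn (by simp)).differentiableAt
        ((h.isOpen.prod isOpen_univ).mem_nhds ⟨hx, mem_univ φ⟩)).hasFDerivAt
    have h2 := h1.comp_hasDerivAt φ ((hasDerivAt_const φ x).prodMk (hasDerivAt_id φ))
    have h3 : fderiv ℝ Γ (x, φ) (0, 1) = _ := h2.unique (hΓ' x hx φ)
    have h4 : ((0 : E k), freq τ x) = freq τ x • ((0 : E k), (1 : ℝ)) := by simp
    rw [h4, map_smul, h3, map_neg, smul_add, smul_apply, smul_smul, smul_smul,
      mul_inv_cancel₀ (h.freq_pos hx).ne', one_smul, one_smul, sub_neg_eq_add, add_assoc]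

end PeriodicOrbits

/-! ### Periodic functions on the circle. -/

section Phase

lemma coe_phase_eq_iff {φ ψ : ℝ} :
    (φ : AddCircle (2 * Real.pi)) = ψ ↔ ∃ l : ℤ, φ = ψ + l * (2 * Real.pi) := by
  rw [← sub_eq_zero, ← AddCircle.coe_sub, AddCircle.coe_eq_zero_iff]
  refine exists_congr fun l => ?_
  rw [zsmul_eq_mul, eq_sub_iff_add_eq', eq_comm]

lemma exists_phase_mem_Icc (φ : ℝ) :
    ∃ ψ ∈ Icc 0 (2 * Real.pi), ∃ l : ℤ, φ = ψ + l * (2 * Real.pi) := by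
  have : Fact (0 < 2 * Real.pi) := ⟨Real.two_pi_pos⟩
  obtain ⟨ψ, hψ, h⟩ := AddCircle.eq_coe_Ico (φ : AddCircle (2 * Real.pi))
  exact ⟨ψ, Ico_subset_Icc_self hψ, coe_phase_eq_iff.1 h.symm⟩

/-- A continuous `2π`-periodic function on `K × ℝ`, `K` compact, which is injective up to periods
induces an embedding of `V × 𝕊¹` for `V ⊆ K`. -/
lemma exists_isEmbedding_circle {X Y : Type} [TopologicalSpace X] [TopologicalSpace Y] [T2Space Y]
    {V K : Set X} (hVK : V ⊆ K) (hK : IsCompact K) {G : X × ℝ → Y}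
    (hG : ContinuousOn G (K ×ˢ univ))
    (hper : ∀ x ∈ K, Function.Periodic (fun φ => G (x, φ)) (2 * Real.pi))
    (hinj : ∀ p ∈ K ×ˢ Icc 0 (2 * Real.pi), ∀ q ∈ K ×ˢ Icc 0 (2 * Real.pi), G p = G q →
      p.1 = q.1 ∧ (p.2 : AddCircle (2 * Real.pi)) = q.2) :
    ∃ g : V × AddCircle (2 * Real.pi) → Y, IsEmbedding g ∧
      ∀ (x : V) (φ : ℝ), g (x, (φ : AddCircle (2 * Real.pi))) = G (x, φ) := by
  have : Fact (0 < 2 * Real.pi) := ⟨Real.two_pi_pos⟩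
  have : CompactSpace K := isCompact_iff_compactSpace.1 hK
  let gK : K × AddCircle (2 * Real.pi) → Y := fun p => (hper p.1 p.1.2).lift p.2
  have hgK : ∀ (x : K) (φ : ℝ), gK (x, (φ : AddCircle (2 * Real.pi))) = G (x, φ) :=
    fun x φ => (hper x x.2).lift_coe φ
  have hquot : IsOpenQuotientMap
      (Prod.map id (fun φ : ℝ => (φ : AddCircle (2 * Real.pi))) : K × ℝ → _) :=
    IsOpenQuotientMap.id.prodMap QuotientAddGroup.isOpenQuotientMap_mk
  have hcont : Continuous gK := by
    rw [hquot.isQuotientMap.continuous_iff]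
    have : gK ∘ Prod.map id (fun φ : ℝ => (φ : AddCircle (2 * Real.pi))) =
        fun p : K × ℝ => G ((p.1 : X), p.2) := by
      ext ⟨x, φ⟩
      exact hgK x φ
    rw [this]
    exact hG.comp_continuous (by fun_prop) fun p => ⟨p.1.2, mem_univ _⟩
  have hinjK : Function.Injective gK := by
    rintro ⟨x, θ⟩ ⟨x', θ'⟩ h
    obtain ⟨φ, hφ, rfl⟩ := AddCircle.eq_coe_Ico θ
    obtain ⟨φ', hφ', rfl⟩ := AddCircle.eq_coe_Ico θ'
    rw [hgK, hgK] at h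
    obtain ⟨h1, h2⟩ := hinj _ ⟨x.2, Ico_subset_Icc_self hφ⟩ _ ⟨x'.2, Ico_subset_Icc_self hφ'⟩ h
    exact Prod.ext (Subtype.ext h1) h2
  refine ⟨gK ∘ Prod.map (inclusion hVK) id, ?_, fun x φ => hgK _ φ⟩
  -- A continuous injection from the compact `K × 𝕊¹` into a Hausdorff space is an embedding, and so
  -- is its restriction to `V × 𝕊¹`.
  exact (hcont.isClosedEmbedding hinjK).isEmbedding.comp
    ((IsEmbedding.inclusion hVK).prodMap IsEmbedding.id)

end Phase

/-! ### Persistence of embeddings under small perturbations. -/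

section Stability

variable {P X : Type} [NormedAddCommGroup P] [NormedSpace ℝ P] [FiniteDimensional ℝ P]
  [NormedAddCommGroup X] [NormedSpace ℝ X]

omit [FiniteDimensional ℝ P] in
lemma fderiv_slice {W : Set P} (hW : IsOpen W) {G : P → ℝ → X}
    (hG : ContDiffOn ℝ ∞ (Function.uncurry G) (W ×ˢ univ)) {p : P} (hp : p ∈ W) (ε : ℝ) :
    fderiv ℝ (fun q => G q ε) p =
      (fderiv ℝ (Function.uncurry G) (p, ε)).comp (ContinuousLinearMap.inl ℝ P ℝ) :=
  (hasFDerivAt_slice hW (hG.differentiableOn (by simp)) hp ε).fderiv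

/-- Immersivity at a point is stable under small perturbations. -/
lemma eventually_injective_fderiv {W : Set P} (hW : IsOpen W) {G : P → ℝ → X}
    (hG : ContDiffOn ℝ ∞ (Function.uncurry G) (W ×ˢ univ)) {p : P} (hp : p ∈ W)
    (himm : Function.Injective (fderiv ℝ (fun q => G q 0) p)) :
    ∀ᶠ z : ℝ × P in 𝓝 (0, p), Function.Injective (fderiv ℝ (fun q => G q z.1) z.2) := by
  have hWo : IsOpen (W ×ˢ (univ : Set ℝ)) := hW.prod isOpen_univ
  have h1 : ContinuousAt (fun z : P × ℝ =>
      (fderiv ℝ (Function.uncurry G) z).comp (ContinuousLinearMap.inl ℝ P ℝ)) (p, 0) :=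
    (((hG.fderiv_of_isOpen (m := ∞) hWo (by simp)).continuousOn.continuousAt
      (hWo.mem_nhds ⟨hp, mem_univ _⟩))).clm_comp continuousAt_const
  have h2 : ContinuousAt (fun z : ℝ × P =>
      (fderiv ℝ (Function.uncurry G) (z.2, z.1)).comp (ContinuousLinearMap.inl ℝ P ℝ)) (0, p) :=
    ContinuousAt.comp_of_eq (f := fun z : ℝ × P => (z.2, z.1)) h1 (by fun_prop) rfl
  rw [fderiv_slice hW hG hp] at himm
  have h3 := h2.eventually_mem (ContinuousLinearMap.isOpen_injective.mem_nhds himm)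
  filter_upwards [h3, (continuous_snd.continuousAt (x := ((0 : ℝ), p))).eventually_mem
    (hW.mem_nhds hp)] with z hz hzW
  rw [fderiv_slice hW hG hzW]
  exact hz

/-- Near a point where the unperturbed map is an immersion, the perturbed maps are injective. -/
lemma eventually_local_injective {W : Set P} (hW : IsOpen W) {G : P → ℝ → X}
    (hG : ContDiffOn ℝ ∞ (Function.uncurry G) (W ×ˢ univ)) {p : P} (hp : p ∈ W)
    (himm : Function.Injective (fderiv ℝ (fun q => G q 0) p)) :
    ∀ᶠ z : ℝ × (P × P) in 𝓝 (0, (p, p)), G z.2.1 z.1 = G z.2.2 z.1 → z.2.1 = z.2.2 := by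
  have hWo : IsOpen (W ×ˢ (univ : Set ℝ)) := hW.prod isOpen_univ
  rw [fderiv_slice hW hG hp] at himm
  obtain ⟨K, hK, hanti⟩ := LinearMap.exists_antilipschitzWith
    ((fderiv ℝ (Function.uncurry G) (p, 0)).comp (ContinuousLinearMap.inl ℝ P ℝ)).toLinearMap
    (LinearMap.ker_eq_bot.2 himm)
  have hstrict : HasStrictFDerivAt (Function.uncurry G) (fderiv ℝ (Function.uncurry G) (p, 0))
      (p, 0) :=
    (hG.contDiffAt (hWo.mem_nhds ⟨hp, mem_univ _⟩)).hasStrictFDerivAt (by simp)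
  have hKpos : (0 : ℝ) < K := by exact_mod_cast hK
  -- With `K` the antilipschitz constant of the derivative, this error constant turns equal values
  -- into `‖a - b‖ ≤ ‖a - b‖ / 2`. Strict differentiability in `(p, ε)` makes it uniform in small
  -- `ε`.
  have h1 := hstrict.isLittleO.def (c := (2 * K : ℝ)⁻¹) (by positivity)
  have h2 : Tendsto (fun z : ℝ × (P × P) => ((z.2.1, z.1), (z.2.2, z.1))) (𝓝 (0, (p, p)))
      (𝓝 ((p, 0), (p, 0))) := by
    apply Continuous.tendsto'
    · fun_prop
    · rfl
  filter_upwards [h2.eventually h1] with z hz heq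
  simp only [Function.uncurry, heq, sub_self, zero_sub, norm_neg, Prod.mk_sub_mk] at hz
  have h3 := hanti.le_mul_dist z.2.1 z.2.2
  rw [dist_eq_norm, dist_eq_norm] at h3
  have h4 : ((fderiv ℝ (Function.uncurry G) (p, 0)).comp
      (ContinuousLinearMap.inl ℝ P ℝ)).toLinearMap z.2.1 -
      ((fderiv ℝ (Function.uncurry G) (p, 0)).comp
      (ContinuousLinearMap.inl ℝ P ℝ)).toLinearMap z.2.2 =
      fderiv ℝ (Function.uncurry G) (p, 0) (z.2.1 - z.2.2, 0) := by
    rw [← map_sub]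
    rfl
  rw [h4] at h3
  have h5 : ‖((z.2.1 - z.2.2, 0) : P × ℝ)‖ = ‖z.2.1 - z.2.2‖ := by simp [Prod.norm_def]
  have h6 : (K : ℝ) * ‖fderiv ℝ (Function.uncurry G) (p, 0) (z.2.1 - z.2.2, 0)‖ ≤
      ‖z.2.1 - z.2.2‖ / 2 := by
    refine (mul_le_mul_of_nonneg_left hz hKpos.le).trans (le_of_eq ?_)
    rw [h5]
    field_simp
  have h7 : ‖z.2.1 - z.2.2‖ = 0 := by linarith [norm_nonneg (z.2.1 - z.2.2)]
  exact sub_eq_zero.1 (norm_eq_zero.1 h7)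

end Stability

lemma periodic_int_mul {X : Type} {f : ℝ → X} (h : Function.Periodic f (2 * Real.pi)) (l : ℤ)
    (φ : ℝ) : f (φ + l * (2 * Real.pi)) = f φ := h.int_mul l φ

/-- Smooth embeddings of `U × 𝕊¹` remain smooth embeddings under small smooth perturbations, over
open sets `V` with compact closure in `U`. -/
lemma exists_isSmoothEmbedding_perturbation {k n : ℕ} {U : Set (E k)} (hU : IsOpen U)
    {G : E k × ℝ → ℝ → E n}
    (hG : ContDiffOn ℝ ∞ (Function.uncurry G) ((U ×ˢ univ) ×ˢ univ))
    (hper : ∀ x ∈ U, ∀ ε, Function.Periodic (fun φ => G (x, φ) ε) (2 * Real.pi))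
    (hemb : IsSmoothEmbedding U (fun x φ => G (x, φ) 0))
    {V : Set (E k)} (hVc : IsCompact (closure V)) (hVU : closure V ⊆ U) :
    ∃ ε₀ > (0 : ℝ), ∀ ε : ℝ, |ε| ≤ ε₀ → IsSmoothEmbedding V (fun x φ => G (x, φ) ε) := by
  have hWo : IsOpen (U ×ˢ (univ : Set ℝ)) := hU.prod isOpen_univ
  have hmem : ∀ p ∈ closure V ×ˢ Icc 0 (2 * Real.pi), p ∈ U ×ˢ (univ : Set ℝ) := fun p hp =>
    ⟨hVU hp.1, mem_univ _⟩
  have hKc : IsCompact (closure V ×ˢ Icc 0 (2 * Real.pi)) := hVc.prod isCompact_Icc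
  have himm : ∀ᶠ ε : ℝ in 𝓝 0, ∀ p ∈ closure V ×ˢ Icc 0 (2 * Real.pi),
      Function.Injective (fderiv ℝ (fun q => G q ε) p) :=
    hKc.eventually_forall_of_forall_eventually fun p hp =>
      eventually_injective_fderiv hWo hG (hmem p hp) (hemb.immersion p.1 (hVU hp.1) p.2)
  have hinj : ∀ᶠ ε : ℝ in 𝓝 0, ∀ z ∈ (closure V ×ˢ Icc 0 (2 * Real.pi)) ×ˢ
      (closure V ×ˢ Icc 0 (2 * Real.pi)), G z.1 ε = G z.2 ε →
      z.1.1 = z.2.1 ∧ (z.1.2 : AddCircle (2 * Real.pi)) = z.2.2 := by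
    refine (hKc.prod hKc).eventually_forall_of_forall_eventually ?_
    rintro ⟨p, q⟩ ⟨hp, hq⟩
    have hcont : ∀ p ∈ U ×ˢ (univ : Set ℝ), ContinuousAt (Function.uncurry G) (p, 0) := fun p hp =>
      hG.continuousOn.continuousAt ((hWo.prod isOpen_univ).mem_nhds ⟨hp, mem_univ _⟩)
    -- If the values agree, the points differ by whole turns `l` of the phase; shifting `q` by `l`
    -- turns brings the pair to the diagonal, where local injectivity applies. Otherwise the values
    -- stay distinct nearby.
    by_cases hpq : G p 0 = G q 0
    · obtain ⟨g, hg, hgG⟩ := hemb.embedding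
      have h1 : ((⟨p.1, hVU hp.1⟩ : U), (p.2 : AddCircle (2 * Real.pi))) =
          ((⟨q.1, hVU hq.1⟩ : U), (q.2 : AddCircle (2 * Real.pi))) := by
        apply hg.injective
        rw [hgG, hgG]
        exact hpq
      have h2 : p.1 = q.1 := congr_arg (fun z => (z.1 : E k)) h1
      obtain ⟨l, hl⟩ := coe_phase_eq_iff.1 (congr_arg Prod.snd h1)
      have h3 := eventually_local_injective hWo hG (hmem p hp)
        (hemb.immersion p.1 (hVU hp.1) p.2)
      have h4 : Tendsto (fun z : ℝ × ((E k × ℝ) × (E k × ℝ)) =>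
          (z.1, (z.2.1, (z.2.2.1, z.2.2.2 + l * (2 * Real.pi))))) (𝓝 (0, (p, q)))
          (𝓝 (0, (p, p))) := by
        apply Continuous.tendsto'
        · fun_prop
        · simp only [← h2, ← hl]
      have h5 : ∀ᶠ z : ℝ × ((E k × ℝ) × (E k × ℝ)) in 𝓝 (0, (p, q)), z.2.2.1 ∈ U :=
        (by fun_prop : ContinuousAt (fun z : ℝ × ((E k × ℝ) × (E k × ℝ)) => z.2.2.1)
          (0, (p, q))).eventually_mem (hU.mem_nhds (hVU hq.1))
      filter_upwards [h4.eventually h3, h5] with z hz hzU heq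
      have h6 := hz (by rw [heq]; exact (periodic_int_mul (hper _ hzU z.1) l z.2.2.2).symm)
      exact ⟨(Prod.ext_iff.1 h6).1, coe_phase_eq_iff.2 ⟨l, (Prod.ext_iff.1 h6).2⟩⟩
    · have h1 : ContinuousAt (fun z : ℝ × ((E k × ℝ) × (E k × ℝ)) => G z.2.1 z.1) (0, (p, q)) :=
        ContinuousAt.comp_of_eq (f := fun z : ℝ × ((E k × ℝ) × (E k × ℝ)) => (z.2.1, z.1))
          (hcont p (hmem p hp)) (by fun_prop) rfl
      have h2 : ContinuousAt (fun z : ℝ × ((E k × ℝ) × (E k × ℝ)) => G z.2.2 z.1) (0, (p, q)) :=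
        ContinuousAt.comp_of_eq (f := fun z : ℝ × ((E k × ℝ) × (E k × ℝ)) => (z.2.2, z.1))
          (hcont q (hmem q hq)) (by fun_prop) rfl
      filter_upwards [(h1.prodMk h2).eventually_mem
        (isClosed_diagonal.isOpen_compl.mem_nhds hpq)] with z hz heq
      exact absurd heq hz
  obtain ⟨r, hr, hball⟩ := Metric.eventually_nhds_iff_ball.1 (himm.and hinj)
  refine ⟨r / 2, half_pos hr, fun ε hε => ?_⟩
  obtain ⟨h1, h2⟩ := hball ε (by
    rw [Metric.mem_ball, dist_zero_right, Real.norm_eq_abs]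
    linarith)
  have hslice : ContDiffOn ℝ ∞ (fun p => G p ε) (U ×ˢ univ) :=
    hG.comp (contDiff_id.prodMk contDiff_const).contDiffOn fun p hp => ⟨hp, mem_univ _⟩
  refine ⟨hslice.mono (prod_mono_left (subset_closure.trans hVU)), fun x hx φ => ?_, ?_⟩
  · obtain ⟨ψ, hψ, l, rfl⟩ := exists_phase_mem_Icc φ
    change Function.Injective (fderiv ℝ (fun q => G q ε) (x, ψ + l * (2 * Real.pi)))
    rw [fderiv_add_phase hU (fun y hy φ => periodic_int_mul (hper y hy ε) l φ)
      (hVU (subset_closure hx))]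
    exact h1 _ ⟨subset_closure hx, hψ⟩
  · exact exists_isEmbedding_circle (G := fun p => G p ε) subset_closure hVc
      (hslice.continuousOn.mono (prod_mono_left hVU)) (fun x hx => hper x (hVU hx) ε)
      (fun p hp q hq heq => h2 (p, q) ⟨hp, hq⟩ heq)

/-! ### Approximate conjugacies and the induction on the order. -/

section ApproximateConjugacy

variable {k n m : ℕ} {F : ℕ → E n → E n} {U : Set (E k)} {γ₀ : E k → ℝ → E n} {τ : E k → ℝ}

/-- `G(·, ε)` conjugates the skew-product vector field `R(·, ε)` to `F(·, ε)` up to an error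
`ε^j H`. -/
structure IsApproximateConjugacy (F : ℕ → E n → E n) (m : ℕ) (U : Set (E k))
    (γ₀ : E k → ℝ → E n) (τ : E k → ℝ) (j : ℕ) (G : E k × ℝ → ℝ → E n)
    (R : E k → ℝ → E k × ℝ) : Prop where
  smooth : ContDiffOn ℝ ∞ (Function.uncurry G) ((U ×ˢ univ) ×ˢ univ)
  smooth_field : ContDiffOn ℝ ∞ (Function.uncurry R) (U ×ˢ univ)
  periodic : ∀ x ∈ U, ∀ φ, G (x, φ + 2 * Real.pi) = G (x, φ)
  unperturbed : ∀ p, G p 0 = phaseParam γ₀ τ p.1 p.2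
  unperturbed_field : ∀ x, R x 0 = (0, freq τ x)
  defect : ∃ H : E k × ℝ → ℝ → E n,
    ContDiffOn ℝ ∞ (Function.uncurry H) ((U ×ˢ univ) ×ˢ univ) ∧
    (∀ x ∈ U, ∀ φ, H (x, φ + 2 * Real.pi) = H (x, φ)) ∧
    ∀ x ∈ U, ∀ φ ε, perturbedField F m ε (G (x, φ) ε) -
      fderiv ℝ (fun q => G q ε) (x, φ) (R x ε) = ε ^ j • H (x, φ) ε

lemma contDiff_perturbedField (hF : ∀ i ≤ m, ContDiff ℝ ∞ (F i)) :
    ContDiff ℝ ∞ (fun q : ℝ × E n => perturbedField F m q.1 q.2) := by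
  refine ContDiff.sum fun i hi => ?_
  have := hF i (Nat.lt_succ_iff.1 (Finset.mem_range.1 hi))
  fun_prop

lemma perturbedField_zero (F : ℕ → E n → E n) (m : ℕ) (z : E n) :
    perturbedField F m 0 z = F 0 z := by
  rw [perturbedField, Finset.sum_range_succ']
  simp

lemma perturbedField_eq_add (F : ℕ → E n → E n) (m : ℕ) (ε : ℝ) (z : E n) :
    perturbedField F m ε z = F 0 z + ε • ∑ i ∈ Finset.range m, ε ^ i • F (i + 1) z := by
  rw [perturbedField, Finset.sum_range_succ', Finset.smul_sum, add_comm]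
  simp [smul_smul, pow_succ']

/-- The family of orbits is an exact conjugacy for `F 0`, so only the terms of the field with a
factor `ε` remain in the defect. -/
lemma isApproximateConjugacy_one (h : IsPeriodicOrbitFamily (F 0) U γ₀ τ)
    (hF : ∀ i ≤ m, ContDiff ℝ ∞ (F i)) :
    IsApproximateConjugacy F m U γ₀ τ 1 (fun p _ => phaseParam γ₀ τ p.1 p.2)
      (fun x _ => (0, freq τ x)) where
  smooth := h.embedding.smooth.comp contDiffOn_fst fun p hp => hp.1
  smooth_field := contDiffOn_const.prodMk (h.contDiffOn_freq.comp contDiffOn_fst fun p hp => hp.1)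
  periodic x hx φ := funext fun _ => h.phaseParam_periodic hx φ
  unperturbed _ := rfl
  unperturbed_field _ := rfl
  defect := by
    refine ⟨fun p ε => ∑ i ∈ Finset.range m, ε ^ i • F (i + 1) (phaseParam γ₀ τ p.1 p.2),
      ?_, fun x hx φ => ?_, fun x hx φ ε => ?_⟩
    · refine ContDiffOn.sum fun i hi => ContDiffOn.smul (contDiff_snd.pow i).contDiffOn ?_
      exact (hF (i + 1) (Finset.mem_range.1 hi)).comp_contDiffOn
        (h.embedding.smooth.comp contDiffOn_fst fun p hp => hp.1)
    · have h1 : phaseParam γ₀ τ x (φ + 2 * Real.pi) = phaseParam γ₀ τ x φ :=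
        h.phaseParam_periodic hx φ
      simp only [h1]
    · have h1 : ((0 : E k), freq τ x) = freq τ x • ((0 : E k), (1 : ℝ)) := by simp
      rw [h1, map_smul, h.fderiv_phaseParam_phase hx, smul_smul,
        mul_inv_cancel₀ (h.freq_pos hx).ne', one_smul, perturbedField_eq_add, add_sub_cancel_left,
        pow_one]

/-- The increment of the vector field between `G` and `G + δ Γ`. -/
noncomputable def fieldIncrement (F : ℕ → E n → E n) (m : ℕ) (G : E k × ℝ → ℝ → E n)
    (Γ : E k × ℝ → E n) (q : (E k × ℝ) × ℝ) (δ : ℝ) : E n :=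
  perturbedField F m q.2 (G q.1 q.2 + δ • Γ q.1) - perturbedField F m q.2 (G q.1 q.2)

lemma contDiffOn_fieldIncrement (hF : ∀ i ≤ m, ContDiff ℝ ∞ (F i)) {W : Set (E k × ℝ)}
    {G : E k × ℝ → ℝ → E n} {Γ : E k × ℝ → E n}
    (hG : ContDiffOn ℝ ∞ (Function.uncurry G) (W ×ˢ univ)) (hΓ : ContDiffOn ℝ ∞ Γ W) :
    ContDiffOn ℝ ∞ (Function.uncurry (fieldIncrement F m G Γ)) ((W ×ˢ univ) ×ˢ univ) := by
  have hPF := contDiff_perturbedField (m := m) hF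
  have h1 : ContDiffOn ℝ ∞ (fun z : ((E k × ℝ) × ℝ) × ℝ => G z.1.1 z.1.2)
      ((W ×ˢ univ) ×ˢ univ) := hG.comp contDiffOn_fst fun z hz => hz.1
  have h2 : ContDiffOn ℝ ∞ (fun z : ((E k × ℝ) × ℝ) × ℝ => z.2 • Γ z.1.1)
      ((W ×ˢ univ) ×ˢ univ) :=
    contDiffOn_snd.smul (hΓ.comp (contDiff_fst.comp contDiff_fst).contDiffOn fun z hz => hz.1.1)
  have h3 : ContDiffOn ℝ ∞ (fun z : ((E k × ℝ) × ℝ) × ℝ => z.1.2)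
      ((W ×ˢ univ) ×ˢ univ) := (contDiff_snd.comp contDiff_fst).contDiffOn
  exact (hPF.comp_contDiffOn (h3.prodMk (h1.add h2))).sub (hPF.comp_contDiffOn (h3.prodMk h1))

lemma smul_hadamardQuotient_fieldIncrement (hF : ∀ i ≤ m, ContDiff ℝ ∞ (F i))
    (G : E k × ℝ → ℝ → E n) (Γ : E k × ℝ → E n) (q : (E k × ℝ) × ℝ) (δ : ℝ) :
    δ • hadamardQuotient (fieldIncrement F m G Γ) q δ = fieldIncrement F m G Γ q δ := by
  have h1 : ContDiff ℝ ∞ fun δ : ℝ => (q.2, G q.1 q.2 + δ • Γ q.1) := by fun_prop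
  have h2 : ContDiff ℝ ∞ (fieldIncrement F m G Γ q) :=
    ((contDiff_perturbedField (m := m) hF).comp h1).sub contDiff_const
  exact smul_hadamardQuotient (h2.of_le (by simp)) (by simp [fieldIncrement]) δ

/-- This supplies the term `DF₀(Γ₀) Γ` of the homological equation. -/
lemma hadamardQuotient_fieldIncrement_zero (hF : ContDiff ℝ ∞ (F 0))
    {G : E k × ℝ → ℝ → E n} {Γ : E k × ℝ → E n} (p : E k × ℝ) :
    hadamardQuotient (fieldIncrement F m G Γ) (p, 0) 0 = fderiv ℝ (F 0) (G p 0) (Γ p) := by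
  rw [hadamardQuotient_zero]
  have h1 : fieldIncrement F m G Γ (p, 0) = fun δ => F 0 (G p 0 + δ • Γ p) - F 0 (G p 0) := by
    ext1 δ
    simp only [fieldIncrement, perturbedField_zero]
  have h2 : HasDerivAt (fun δ : ℝ => G p 0 + δ • Γ p) (Γ p) 0 := by
    simpa using ((hasDerivAt_id (0 : ℝ)).smul_const (Γ p)).const_add (G p 0)
  have h3 : HasFDerivAt (F 0) (fderiv ℝ (F 0) (G p 0)) (G p 0 + (0 : ℝ) • Γ p) := by
    rw [zero_smul, add_zero]
    exact (hF.differentiable (by simp)).differentiableAt.hasFDerivAt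
  rw [h1]
  exact ((h3.comp_hasDerivAt 0 h2).sub_const _).deriv

/-- The defect after the corrections `ε^j Γ` and `ε^j r`, divided by `ε^j`, if the defect before was
`ε^j H`. -/
noncomputable def correctedDefect (F : ℕ → E n → E n) (m j : ℕ) (G : E k × ℝ → ℝ → E n)
    (R : E k → ℝ → E k × ℝ) (H : E k × ℝ → ℝ → E n) (Γ : E k × ℝ → E n) (r : E k → E k × ℝ)
    (p : E k × ℝ) (ε : ℝ) : E n :=
  hadamardQuotient (fieldIncrement F m G Γ) (p, ε) (ε ^ j) + H p ε -
    fderiv ℝ Γ p (R p.1 ε) - fderiv ℝ (fun q => G q ε) p (r p.1) - ε ^ j • fderiv ℝ Γ p (r p.1)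

lemma contDiffOn_correctedDefect (hF : ∀ i ≤ m, ContDiff ℝ ∞ (F i)) (hU : IsOpen U) (j : ℕ)
    {G : E k × ℝ → ℝ → E n} {R : E k → ℝ → E k × ℝ} {H : E k × ℝ → ℝ → E n}
    {Γ : E k × ℝ → E n} {r : E k → E k × ℝ}
    (hG : ContDiffOn ℝ ∞ (Function.uncurry G) ((U ×ˢ univ) ×ˢ univ))
    (hR : ContDiffOn ℝ ∞ (Function.uncurry R) (U ×ˢ univ))
    (hH : ContDiffOn ℝ ∞ (Function.uncurry H) ((U ×ˢ univ) ×ˢ univ))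
    (hΓ : ContDiffOn ℝ ∞ Γ (U ×ˢ univ)) (hr : ContDiffOn ℝ ∞ r U) :
    ContDiffOn ℝ ∞ (Function.uncurry (correctedDefect F m j G R H Γ r))
      ((U ×ˢ univ) ×ˢ univ) := by
  have hWo : IsOpen (U ×ˢ (univ : Set ℝ)) := hU.prod isOpen_univ
  have hWo' : IsOpen ((U ×ˢ (univ : Set ℝ)) ×ˢ (univ : Set ℝ)) := hWo.prod isOpen_univ
  have hfst : MapsTo (Prod.fst : (E k × ℝ) × ℝ → E k × ℝ) ((U ×ˢ univ) ×ˢ univ) (U ×ˢ univ) :=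
    fun p hp => hp.1
  have hr1 : ContDiffOn ℝ ∞ (fun q : (E k × ℝ) × ℝ => r q.1.1) ((U ×ˢ univ) ×ˢ univ) :=
    hr.comp (contDiff_fst.comp contDiff_fst).contDiffOn fun p hp => hp.1.1
  have hR1 : ContDiffOn ℝ ∞ (fun q : (E k × ℝ) × ℝ => R q.1.1 q.2) ((U ×ˢ univ) ×ˢ univ) :=
    hR.comp (f := fun q : (E k × ℝ) × ℝ => (q.1.1, q.2))
      ((contDiff_fst.comp contDiff_fst).prodMk contDiff_snd).contDiffOn
      fun p hp => ⟨hp.1.1, mem_univ _⟩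
  have hDΓ : ContDiffOn ℝ ∞ (fun q : (E k × ℝ) × ℝ => fderiv ℝ Γ q.1) ((U ×ˢ univ) ×ˢ univ) :=
    (hΓ.fderiv_of_isOpen hWo (by simp)).comp contDiffOn_fst hfst
  have hDG : ContDiffOn ℝ ∞ (fun q : (E k × ℝ) × ℝ => fderiv ℝ (fun p => G p q.2) q.1)
      ((U ×ˢ univ) ×ˢ univ) :=
    ((hG.fderiv_of_isOpen (m := ∞) hWo' (by simp)).clm_comp contDiffOn_const).congr
      fun q hq => fderiv_slice hWo hG hq.1 q.2
  have hpow : ContDiff ℝ ∞ (fun q : (E k × ℝ) × ℝ => q.2 ^ j) := contDiff_snd.pow j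
  have h1 : ContDiffOn ℝ ∞
      (fun q : (E k × ℝ) × ℝ => hadamardQuotient (fieldIncrement F m G Γ) q (q.2 ^ j))
      ((U ×ˢ univ) ×ˢ univ) :=
    (contDiffOn_hadamardQuotient hWo' (contDiffOn_fieldIncrement hF hG hΓ)).comp
      (f := fun q : (E k × ℝ) × ℝ => (q, q.2 ^ j)) (contDiff_id.prodMk hpow).contDiffOn
      fun q hq => ⟨hq, mem_univ _⟩
  exact (((h1.add hH).sub (hDΓ.clm_apply hR1)).sub (hDG.clm_apply hr1)).sub
    (hpow.contDiffOn.smul (hDΓ.clm_apply hr1))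

/-- An exact identity: the Hadamard quotient of the field increment replaces a Taylor expansion with
remainder. -/
lemma defect_add_smul (hF : ∀ i ≤ m, ContDiff ℝ ∞ (F i)) (j : ℕ)
    {G : E k × ℝ → ℝ → E n} {R : E k → ℝ → E k × ℝ} {H : E k × ℝ → ℝ → E n}
    {Γ : E k × ℝ → E n} {r : E k → E k × ℝ} {p : E k × ℝ} {ε : ℝ}
    (hdG : DifferentiableAt ℝ (fun q => G q ε) p) (hdΓ : DifferentiableAt ℝ Γ p)
    (h : perturbedField F m ε (G p ε) - fderiv ℝ (fun q => G q ε) p (R p.1 ε) = ε ^ j • H p ε) :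
    perturbedField F m ε (G p ε + ε ^ j • Γ p) -
      fderiv ℝ (fun q => G q ε + ε ^ j • Γ q) p (R p.1 ε + ε ^ j • r p.1) =
        ε ^ j • correctedDefect F m j G R H Γ r p ε := by
  have h1 : fderiv ℝ (fun q => G q ε + ε ^ j • Γ q) p =
      fderiv ℝ (fun q => G q ε) p + ε ^ j • fderiv ℝ Γ p :=
    (hdG.hasFDerivAt.add (hdΓ.hasFDerivAt.const_smul (ε ^ j))).fderiv
  have h2 : perturbedField F m ε (G p ε + ε ^ j • Γ p) = perturbedField F m ε (G p ε) +
      ε ^ j • hadamardQuotient (fieldIncrement F m G Γ) (p, ε) (ε ^ j) := by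
    rw [smul_hadamardQuotient_fieldIncrement hF]
    simp [fieldIncrement]
  rw [sub_eq_iff_eq_add] at h
  rw [h1, h2, h]
  simp only [correctedDefect, add_apply, smul_apply, map_add, map_smul]
  module

/-- Solving one homological equation raises the order of an approximate conjugacy by one. -/
lemma IsApproximateConjugacy.exists_succ (h : IsPeriodicOrbitFamily (F 0) U γ₀ τ)
    (hhyp : IsNormallyHyperbolic (F 0) U γ₀ τ) (hF : ∀ i ≤ m, ContDiff ℝ ∞ (F i))
    {j : ℕ} (hj : j ≠ 0) {G : E k × ℝ → ℝ → E n} {R : E k → ℝ → E k × ℝ}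
    (hGR : IsApproximateConjugacy F m U γ₀ τ j G R) :
    ∃ (r : E k → E k × ℝ) (Γ : E k × ℝ → E n), ContDiffOn ℝ ∞ r U ∧
      ContDiffOn ℝ ∞ Γ (U ×ˢ univ) ∧ (∀ x ∈ U, ∀ φ, Γ (x, φ + 2 * Real.pi) = Γ (x, φ)) ∧
      IsApproximateConjugacy F m U γ₀ τ (j + 1) (fun p ε => G p ε + ε ^ j • Γ p)
        (fun x ε => R x ε + ε ^ j • r x) := by
  obtain ⟨H, hH, hHper, hdef⟩ := hGR.defect
  have hWo : IsOpen (U ×ˢ (univ : Set ℝ)) := h.isOpen.prod isOpen_univ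
  obtain ⟨r, Γ, hr, hΓ, hrΓ⟩ := exists_homological_solution h hhyp (hF 0 (Nat.zero_le m))
    (g := fun p => H p 0)
    (hH.comp (contDiff_id.prodMk contDiff_const).contDiffOn fun p hp => ⟨hp, mem_univ _⟩)
    (fun x hx φ => congr_fun (hHper x hx φ) 0)
  have hG := hGR.smooth
  obtain ⟨Q, hQdef⟩ : ∃ Q, Q = correctedDefect F m j G R H Γ r := ⟨_, rfl⟩
  have hQ : ContDiffOn ℝ ∞ (Function.uncurry Q) ((U ×ˢ univ) ×ˢ univ) :=
    hQdef ▸ contDiffOn_correctedDefect hF h.isOpen j hG hGR.smooth_field hH hΓ hr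
  have hQline : ∀ x ∈ U, ∀ φ, ContDiff ℝ ∞ (Q (x, φ)) := fun x hx φ =>
    contDiffOn_univ.1 (hQ.comp (contDiff_const.prodMk contDiff_id).contDiffOn
      fun ε _ => ⟨⟨hx, mem_univ _⟩, mem_univ _⟩)
  -- This is the homological equation itself. Since `j ≠ 0`, the increment `ε ^ j` vanishes at `ε =
  -- 0` and the quotient becomes a derivative. Hence `Q` is `ε` times its smooth Hadamard quotient.
  have hQ0 : ∀ x ∈ U, ∀ φ, Q (x, φ) 0 = 0 := by
    intro x hx φ
    simp only [hQdef, correctedDefect, zero_pow hj, zero_smul, sub_zero,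
      hadamardQuotient_fieldIncrement_zero (hF 0 (Nat.zero_le m)), hGR.unperturbed,
      hGR.unperturbed_field, (hrΓ x hx φ).2]
    abel
  have hQper : ∀ x ∈ U, ∀ φ, Q (x, φ + 2 * Real.pi) = Q (x, φ) := by
    intro x hx φ
    ext1 ε
    have h1 : fieldIncrement F m G Γ ((x, φ + 2 * Real.pi), ε) =
        fieldIncrement F m G Γ ((x, φ), ε) := by
      ext1 δ
      rw [fieldIncrement, fieldIncrement, hGR.periodic x hx, (hrΓ x hx φ).1]
    have h2 := fderiv_add_phase h.isOpen (fun y hy ψ => (hrΓ y hy ψ).1) hx φ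
    have h3 := fderiv_add_phase (G := fun q => G q ε) h.isOpen
        (fun y hy ψ => congr_fun (hGR.periodic y hy ψ) ε) hx φ
    simp only [hQdef, correctedDefect, hadamardQuotient, h1, hHper x hx, h2, h3]
  refine ⟨r, Γ, hr, hΓ, fun x hx φ => (hrΓ x hx φ).1, ?_, ?_, ?_, ?_, ?_,
    hadamardQuotient Q, contDiffOn_hadamardQuotient hWo hQ, ?_, ?_⟩
  · exact hG.add ((contDiff_snd.pow j).contDiffOn.smul
      (hΓ.comp contDiffOn_fst fun p hp => hp.1))
  · exact hGR.smooth_field.add ((contDiff_snd.pow j).contDiffOn.smul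
      (hr.comp contDiffOn_fst fun p hp => hp.1))
  · intro x hx φ
    simp only [hGR.periodic x hx, (hrΓ x hx φ).1]
  · intro p
    simp [hGR.unperturbed, zero_pow hj]
  · intro x
    simp [hGR.unperturbed_field, zero_pow hj]
  · intro x hx φ
    ext1 ε
    simp only [hadamardQuotient, hQper x hx]
  · intro x hx φ ε
    have hmem : (x, φ) ∈ U ×ˢ (univ : Set ℝ) := ⟨hx, mem_univ _⟩
    have hdG : DifferentiableAt ℝ (fun q => G q ε) (x, φ) :=
      (hasFDerivAt_slice hWo (hG.differentiableOn (by simp)) hmem ε).differentiableAt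
    have hdΓ : DifferentiableAt ℝ Γ (x, φ) :=
      (hΓ.differentiableOn (by simp)).differentiableAt (hWo.mem_nhds hmem)
    rw [pow_succ, mul_smul, smul_hadamardQuotient ((hQline x hx φ).of_le (by simp))
      (hQ0 x hx φ)]
    rw [hQdef]
    exact defect_add_smul hF j hdG hdΓ (hdef x hx φ ε)

lemma exists_approximateConjugacy (h : IsPeriodicOrbitFamily (F 0) U γ₀ τ)
    (hhyp : IsNormallyHyperbolic (F 0) U γ₀ τ) (hF : ∀ i ≤ m, ContDiff ℝ ∞ (F i)) (j : ℕ) :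
    ∃ (r : ℕ → E k → E k × ℝ) (Γ : ℕ → E k × ℝ → E n),
      (∀ i ∈ Finset.Icc 1 j, ContDiffOn ℝ ∞ (r i) U ∧ ContDiffOn ℝ ∞ (Γ i) (U ×ˢ univ) ∧
        ∀ x ∈ U, ∀ φ, Γ i (x, φ + 2 * Real.pi) = Γ i (x, φ)) ∧
      IsApproximateConjugacy F m U γ₀ τ (j + 1)
        (fun p ε => phaseParam γ₀ τ p.1 p.2 + ∑ i ∈ Finset.Icc 1 j, ε ^ i • Γ i p)
        (fun x ε => (0, freq τ x) + ∑ i ∈ Finset.Icc 1 j, ε ^ i • r i x) := by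
  induction j with
  | zero =>
    refine ⟨fun _ _ => 0, fun _ _ => 0, by simp, ?_⟩
    simpa using isApproximateConjugacy_one h hF
  | succ j ih =>
    obtain ⟨r, Γ, hs, hc⟩ := ih
    obtain ⟨r', Γ', hr', hΓ', hper, hc'⟩ := hc.exists_succ h hhyp hF j.succ_ne_zero
    have hne : ∀ i ∈ Finset.Icc 1 j, i ≠ j + 1 := fun i hi =>
      (Nat.lt_succ_of_le (Finset.mem_Icc.1 hi).2).ne
    refine ⟨Function.update r (j + 1) r', Function.update Γ (j + 1) Γ', fun i hi => ?_, ?_⟩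
    · rcases eq_or_ne i (j + 1) with rfl | hij
      · simp only [Function.update_self]
        exact ⟨hr', hΓ', hper⟩
      · simp only [Function.update_of_ne hij]
        exact hs i (Finset.mem_Icc.2 ⟨(Finset.mem_Icc.1 hi).1,
          Nat.lt_succ_iff.1 (lt_of_le_of_ne (Finset.mem_Icc.1 hi).2 hij)⟩)
    · have h1 : ∀ (p : E k × ℝ) (ε : ℝ),
          ∑ i ∈ Finset.Icc 1 (j + 1), ε ^ i • Function.update Γ (j + 1) Γ' i p =
            ∑ i ∈ Finset.Icc 1 j, ε ^ i • Γ i p + ε ^ (j + 1) • Γ' p := by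
        intro p ε
        rw [Finset.sum_Icc_succ_top (by simp), Function.update_self]
        congr 1
        exact Finset.sum_congr rfl fun i hi => by rw [Function.update_of_ne (hne i hi)]
      have h2 : ∀ (x : E k) (ε : ℝ),
          ∑ i ∈ Finset.Icc 1 (j + 1), ε ^ i • Function.update r (j + 1) r' i x =
            ∑ i ∈ Finset.Icc 1 j, ε ^ i • r i x + ε ^ (j + 1) • r' x := by
        intro x ε
        rw [Finset.sum_Icc_succ_top (by simp), Function.update_self]
        congr 1
        exact Finset.sum_congr rfl fun i hi => by rw [Function.update_of_ne (hne i hi)]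
      simp only [h1, h2, ← add_assoc]
      exact hc'

/-- The defect of an approximate conjugacy is bounded by `C |ε|^j`, uniformly over compact sets. -/
lemma IsApproximateConjugacy.exists_defect_bound {j : ℕ} {G : E k × ℝ → ℝ → E n}
    {R : E k → ℝ → E k × ℝ} (hGR : IsApproximateConjugacy F m U γ₀ τ j G R) {K : Set (E k)}
    (hK : IsCompact K) (hKU : K ⊆ U) (ε₀ : ℝ) :
    ∃ C : ℝ, ∀ ε, |ε| ≤ ε₀ → ∀ x ∈ K, ∀ φ, ‖fderiv ℝ (fun q => G q ε) (x, φ) (R x ε) -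
      perturbedField F m ε (G (x, φ) ε)‖ ≤ C * |ε| ^ j := by
  obtain ⟨H, hH, hHper, hdef⟩ := hGR.defect
  -- One period of the phase and a compact range of `ε` give a single bound for `H`; periodicity
  -- covers the other phases.
  have hcomp : IsCompact ((K ×ˢ Icc 0 (2 * Real.pi)) ×ˢ Icc (-ε₀) ε₀) :=
    (hK.prod isCompact_Icc).prod isCompact_Icc
  obtain ⟨C, hC⟩ := hcomp.exists_bound_of_continuousOn
    (hH.continuousOn.mono (prod_mono (prod_mono hKU (subset_univ _)) (subset_univ _)))
  refine ⟨C, fun ε hε x hx φ => ?_⟩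
  rw [norm_sub_rev, hdef x (hKU hx), norm_smul, norm_pow, Real.norm_eq_abs, mul_comm]
  refine mul_le_mul_of_nonneg_right ?_ (by positivity)
  obtain ⟨ψ, hψ, l, rfl⟩ := exists_phase_mem_Icc φ
  have h1 : H (x, ψ + l * (2 * Real.pi)) = H (x, ψ) :=
    periodic_int_mul (f := fun φ => H (x, φ)) (hHper x (hKU hx)) l ψ
  rw [h1]
  exact hC ((x, ψ), ε) ⟨⟨hx, hψ⟩, abs_le.1 hε⟩

end ApproximateConjugacy

end SkewProduct

/-! ### The main theorem. -/

theorem mainTheorem1 (k n m : ℕ) (hk : 1 ≤ k) (hkn : k + 1 < n) (hm : 1 ≤ m)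
    (F : ℕ → SkewProduct.E n → SkewProduct.E n) (hF : ∀ i ≤ m, ContDiff ℝ ∞ (F i))
    (U : Set (SkewProduct.E k)) (γ₀ : SkewProduct.E k → ℝ → SkewProduct.E n)
    (τ : SkewProduct.E k → ℝ)
    (hfam : SkewProduct.IsPeriodicOrbitFamily (F 0) U γ₀ τ)
    (hhyp : SkewProduct.IsNormallyHyperbolic (F 0) U γ₀ τ) :
    ∃ (rx : ℕ → SkewProduct.E k → SkewProduct.E k) (rφ : ℕ → SkewProduct.E k → ℝ)
      (Γ : ℕ → SkewProduct.E k → ℝ → SkewProduct.E n),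
      (∀ i ∈ Finset.Icc 1 m,
        ContDiffOn ℝ ∞ (rx i) U ∧ ContDiffOn ℝ ∞ (rφ i) U ∧
        ContDiffOn ℝ ∞ (fun p : SkewProduct.E k × ℝ => Γ i p.1 p.2) (U ×ˢ Set.univ) ∧
        ∀ x ∈ U, Function.Periodic (Γ i x) (2 * Real.pi)) ∧
      ∀ V : Set (SkewProduct.E k), IsOpen V → IsCompact (closure V) → closure V ⊆ U →
        ∃ ε₀ > (0 : ℝ), ∃ C : ℝ, ∀ ε : ℝ, |ε| ≤ ε₀ →
          SkewProduct.IsSmoothEmbedding V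
            (fun x φ => SkewProduct.expansion γ₀ τ Γ m x φ ε) ∧
          ∀ (J : Set ℝ) (x : ℝ → SkewProduct.E k) (φ : ℝ → ℝ), J.OrdConnected →
            (∀ t ∈ J, x t ∈ V ∧
              HasDerivWithinAt x (SkewProduct.slowField rx m (x t) ε) J t ∧
              HasDerivWithinAt φ (SkewProduct.phaseField τ rφ m (x t) ε) J t) →
            ∀ t ∈ J, ∃ R : SkewProduct.E n,
              HasDerivWithinAt (fun s => SkewProduct.expansion γ₀ τ Γ m (x s) (φ s) ε)
                (SkewProduct.perturbedField F m ε
                  (SkewProduct.expansion γ₀ τ Γ m (x t) (φ t) ε) + R) J t ∧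
              ‖R‖ ≤ C * |ε| ^ (m + 1) := by
  obtain ⟨r, Γ, hs, hc⟩ := SkewProduct.exists_approximateConjugacy hfam hhyp hF m
  refine ⟨fun i x => (r i x).1, fun i x => (r i x).2, fun i x φ => Γ i (x, φ), fun i hi => ?_,
    fun V _ hVc hVU => ?_⟩
  · obtain ⟨h1, h2, h3⟩ := hs i hi
    exact ⟨contDiff_fst.comp_contDiffOn h1, contDiff_snd.comp_contDiffOn h1, h2, h3⟩
  have hemb : SkewProduct.IsSmoothEmbedding U (fun x φ =>
      (fun (p : SkewProduct.E k × ℝ) (ε : ℝ) => SkewProduct.phaseParam γ₀ τ p.1 p.2 +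
        ∑ i ∈ Finset.Icc 1 m, ε ^ i • Γ i p) (x, φ) 0) := by
    have h0 := hc.unperturbed
    have : SkewProduct.phaseParam γ₀ τ = fun x φ => SkewProduct.phaseParam γ₀ τ x φ +
        ∑ i ∈ Finset.Icc 1 m, (0 : ℝ) ^ i • Γ i (x, φ) := by
      ext1 x
      ext1 φ
      exact (h0 (x, φ)).symm
    exact this ▸ hfam.embedding
  obtain ⟨ε₀, hε₀, hE⟩ := SkewProduct.exists_isSmoothEmbedding_perturbation hfam.isOpen hc.smooth
    (fun x hx ε φ => congr_fun (hc.periodic x hx φ) ε) hemb hVc hVU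
  obtain ⟨C, hC⟩ := hc.exists_defect_bound hVc hVU ε₀
  refine ⟨ε₀, hε₀, C, fun ε hε => ⟨hE ε hε, fun J x φ _ hsol t ht => ?_⟩⟩
  obtain ⟨hxV, hx', hφ'⟩ := hsol t ht
  -- The remainder is minus the defect at `(x t, φ t)`, so that the field plus the remainder is the
  -- velocity given by the chain rule.
  refine ⟨_, ?_, hC ε hε (x t) (subset_closure hxV) (φ t)⟩
  have hslice := SkewProduct.hasFDerivAt_slice (hfam.isOpen.prod isOpen_univ)
    (hc.smooth.differentiableOn (by simp)) (p := (x t, φ t))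
    ⟨hVU (subset_closure hxV), Set.mem_univ _⟩ ε
  have hderiv := hslice.differentiableAt.hasFDerivAt.comp_hasDerivWithinAt t (hx'.prodMk hφ')
  refine hderiv.congr_deriv ?_
  have hfield : (SkewProduct.slowField (fun i x => (r i x).1) m (x t) ε,
      SkewProduct.phaseField τ (fun i x => (r i x).2) m (x t) ε) =
      (0, SkewProduct.freq τ (x t)) + ∑ i ∈ Finset.Icc 1 m, ε ^ i • r i (x t) := by
    ext1
    · simp [SkewProduct.slowField, Prod.fst_sum]
    · simp [SkewProduct.phaseField, Prod.snd_sum]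
  rw [hfield, SkewProduct.expansion, add_sub_cancel]
  rfl
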